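/- Conventions. $\mathcal F$ is the Fourier transform in $x\in\mathbb R$ with $\mathcal F f(\xi)=\int e^{-ix\xi}f(x)\,dx$ (up to a constant factor), $P_J f=\mathcal F^{-1}\mathbf 1_J\mathcal F f$ for an interval $J$, and $P_k=P_{[k,k+1]}$, $f_k=P_kf$ for $k\in\mathbb Z$; for functions of $(t,x)$ these act in $x$. For $v:\mathbb R\to L^2(\mathbb R)$ with limits at $\pm\infty$ put $\|v\|_{V^2}=\sup\big(\sum_{k=1}^K\|v(t_k)-v(t_{k-1})\|_{L^2}^2\big)^{1/2}$, the supremum being over all finite partitions $-\infty=t_0<t_1<\dots<t_K=\infty$, with $v(-\infty)=\lim_{t\to-\infty}v(t)$ and $v(\infty):=0$. The space $V^2_\Delta$ consists of all $u:\mathbb R\to L^2(\mathbb R)$ for which $v(t)=e^{-it\partial_x^2}u(t)$ is right continuous, has limits at $\pm\infty$, the limit at $-\infty$ being $0$, and satisfies $\|u\|_{V^2_\Delta}:=\|v\|_{V^2}<\infty$. Lemma 3.6. Let $I=[a,b]$ with $a,b\in\mathbb Z$, $a\le b$, and $|I|=b-a$. 1) There is an absolute constant $C$ such that, if $|I|\ge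 2$, $u_0\in L^2(\mathbb R)$, and $u$ is the solution of the free Schrödinger equation $iu_t+\sigma u_{xx}=0$, $u(0)=u_0$ (with either sign $\sigma\in\{1,-1\}$), i.e. $u(t)=e^{i\sigma t\partial_x^2}u_0$, then $$\|P_Iu\|_{L^4([0,1]\times\mathbb R)}\le C\sqrt{\ln|I|}\Big(\sum_{k\in I\cap\mathbb Z}\|u_{0,k}\|_{L^2}^4\Big)^{1/4},\qquad u_{0,k}=P_ku_0.$$ 2) For every $\beta>1$ there is a constant $C=C(\beta)$ such that, if $|I|\ge2$ and $u:\mathbb R\to L^2(\mathbb R)$ satisfies $u_k\in V^2_\Delta$ for all $k\in I\cap\mathbb Z$, then $$\|P_Iu\|_{L^4([0,1]\times\mathbb R)}\le C(\ln|I|)^{\beta+1/2}\Big(\sum_{k\in I\cap\mathbb Z}\|u_k\|_{V^2_\Delta}^4\Big)^{1/4}.$$ 3) For every $\theta\in(0,1)$ and $\beta>0$ there is a constant $C=C(\theta,\beta)$ such that, for every $T>0$ and every $u:\mathbb R\to L^2(\mathbb R)$ with $u_k\in V^2_\Delta$ for all $k\in I\cap\mathbb Z$, $$\|P_Iu\|_{L^4([0,T]\times\mathbb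 R)}^2\le C\Big(T^{\frac{1-\theta}4}|I|^{2\beta+\frac{1-\theta}2}+T^{1/4}\Big)\Big(\sum_{k\in I\cap\mathbb Z}\|u_k\|_{V^2_\Delta}^4\Big)^{1/2}.$$ -/

import Mathlib

open MeasureTheory Filter Topology Set
open scoped ENNReal NNReal FourierTransform

noncomputable section

namespace LogRestriction

/-- The complex Hilbert space `L²(ℝ)`. -/
abbrev L2 : Type := Lp ℂ 2 (volume : Measure ℝ)

theorem memLp_multiplier_mul (m : ℝ → ℂ) (hm : Measurable m) (hb : ∀ ξ, ‖m ξ‖ ≤ 1) (f : L2) :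
    MemLp (fun ζ : ℝ => m (2 * Real.pi * ζ) * f ζ) 2 volume := by
  refine (Lp.memLp f).of_le_mul (c := 1) ?_ ?_
  · exact ((hm.comp (measurable_const.mul measurable_id)).aestronglyMeasurable).mul
      (Lp.aestronglyMeasurable f)
  · refine Eventually.of_forall fun ζ => ?_
    rw [norm_mul]
    exact mul_le_mul_of_nonneg_right (hb _) (norm_nonneg _)

/-- The Fourier multiplier on `L²(ℝ)` with symbol `m(ξ)`, `|m| ≤ 1`, where `ξ` is the angular
frequency, i.e. the Fourier variable of `∫ e^{-ixξ} f(x) dx`. The transform `𝓕` used here is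
`∫ e^{-2πixζ} f(x) dx`, so that `ξ = 2πζ`. -/
def fourierMul (m : ℝ → ℂ) (hm : Measurable m) (hb : ∀ ξ, ‖m ξ‖ ≤ 1) (f : L2) : L2 :=
  𝓕⁻ ((memLp_multiplier_mul m hm hb (𝓕 f)).toLp _)

theorem measurable_indicator_symbol (a b : ℝ) :
    Measurable ((Icc a b).indicator (fun _ : ℝ => (1 : ℂ))) :=
  measurable_const.indicator measurableSet_Icc

theorem norm_indicator_symbol_le (a b ξ : ℝ) :
    ‖(Icc a b).indicator (fun _ : ℝ => (1 : ℂ)) ξ‖ ≤ 1 := by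
  by_cases h : ξ ∈ Icc a b <;> simp [h]

/-- The frequency projection `P_{[a,b]} f = 𝓕⁻¹ 1_{[a,b]} 𝓕 f`. -/
def freqProj (a b : ℝ) (f : L2) : L2 :=
  fourierMul ((Icc a b).indicator fun _ => 1)
    (measurable_indicator_symbol a b) (norm_indicator_symbol_le a b) f

/-- The unit-scale frequency projection `P_k = P_{[k,k+1]}`. -/
def unitProj (k : ℤ) (f : L2) : L2 := freqProj (k : ℝ) ((k : ℝ) + 1) f

theorem measurable_schrodinger_symbol (t : ℝ) :
    Measurable (fun ξ : ℝ => Complex.exp (((-(t * ξ ^ 2) : ℝ) : ℂ) * Complex.I)) := by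
  fun_prop

theorem norm_schrodinger_symbol_le (t ξ : ℝ) :
    ‖Complex.exp (((-(t * ξ ^ 2) : ℝ) : ℂ) * Complex.I)‖ ≤ 1 :=
  (Complex.norm_exp_ofReal_mul_I _).le

/-- The free Schrödinger group `e^{it∂ₓ²}` on `L²(ℝ)`, the multiplier with symbol `e^{-itξ²}`.
The solution of `i u_t + u_xx = 0`, `u(0) = u₀` is `u(t) = schrodinger t u₀`, and the solution of
`i u_t - u_xx = 0`, `u(0) = u₀` is `u(t) = schrodinger (-t) u₀`. -/
def schrodinger (t : ℝ) (f : L2) : L2 :=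
  fourierMul (fun ξ => Complex.exp (((-(t * ξ ^ 2) : ℝ) : ℂ) * Complex.I))
    (measurable_schrodinger_symbol t) (norm_schrodinger_symbol_le t) f

/-- The norm of `L⁴([0,T] × ℝ) = L⁴_t L⁴_x` of a function of `(t,x)` given as `t ↦ u(t) ∈ L²(ℝ)`,
with value `∞` if `u` is not in this space. -/
def L4norm (T : ℝ) (u : ℝ → L2) : ℝ≥0∞ :=
  (∫⁻ t in Icc 0 T, ∫⁻ x, ‖(u t : ℝ → ℂ) x‖ₑ ^ (4 : ℕ)) ^ (1 / 4 : ℝ)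

/-- The extension of `v : ℝ → L²` to `[-∞, ∞]` by `v(-∞) = lim_{t → -∞} v(t)` and `v(∞) = 0`. -/
def extendEReal (v : ℝ → L2) (t : EReal) : L2 :=
  if t = ⊥ then limUnder atBot v else if t = ⊤ then 0 else v t.toReal

/-- The `V^p` norm: the supremum over all finite partitions `-∞ = t₀ < t₁ < ⋯ < t_K = ∞` of
`(∑_{k=1}^K ‖v(t_k) - v(t_{k-1})‖^p)^{1/p}`. -/
def vNorm (p : ℝ) (v : ℝ → L2) : ℝ≥0∞ :=
  ⨆ (K : ℕ) (t : Fin (K + 1) → EReal) (_ : StrictMono t) (_ : t 0 = ⊥) (_ : t (Fin.last K) = ⊤),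
    (∑ k : Fin K, ‖extendEReal v (t k.succ) - extendEReal v (t k.castSucc)‖ₑ ^ p) ^ (1 / p)

/-- The space `V^p_{-,rc}`: right continuous functions of finite `V^p` norm which have limits at
`±∞`, the limit at `-∞` being zero. -/
structure MemV (p : ℝ) (v : ℝ → L2) : Prop where
  tendsto_atBot : Tendsto v atBot (𝓝 0)
  tendsto_atTop : ∃ l : L2, Tendsto v atTop (𝓝 l)
  rightContinuous : ∀ t : ℝ, ContinuousWithinAt v (Ici t) t
  norm_lt_top : vNorm p v < ∞

/-- The pulled-back function `t ↦ e^{-it∂ₓ²} u(t)`. -/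
def pullback (u : ℝ → L2) : ℝ → L2 := fun t => schrodinger (-t) (u t)

/-- The space `V^p_Δ = e^{it∂ₓ²} V^p_{-,rc}`. -/
def MemVDelta (p : ℝ) (u : ℝ → L2) : Prop := MemV p (pullback u)

/-- The norm of `V^p_Δ`. -/
def vDeltaNorm (p : ℝ) (u : ℝ → L2) : ℝ≥0∞ := vNorm p (pullback u)

end LogRestriction

end

noncomputable section

namespace LogRestriction

/-! Free evolution. On a time window of length `h`, the fourth power of the `L⁴` norm is the squared
`L²` norm of the self-convolution of the evolved Fourier transform. Dominating the window by `e ·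
exp(-|t - c| / h)` and integrating in time first leaves a nonnegative quadrilinear form in `F = |𝓕
f|`, weighted by a Lorentzian of the resonance function `8π²(ξ - ξ')(ξ + ξ' - η)`. With `m = ξ - ξ'`
and `n = ξ + ξ' - η` the integrand is `F(ξ) F(ξ-m) · F(ξ-n) F(ξ-m-n) κ(|mn|)`. For fixed `m` this is
a quadratic form in `G(ξ) = F(ξ) F(ξ-m)`, evaluated at two points that differ by `n`.

By symmetry `|m| ≤ |n|` may be assumed. Schur's test over unit frequency cells, and Cauchy–Schwarz
on each cell, then produce the `ℓ⁴` sum (`lintegral_resonance_le`). The remaining factor is an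
integral of the kernel in `m`, summed over cell distances `d`: it is `O(√h)` for `|d| ≤ 1` and at
most `1/(|d| - 1)` beyond, so the harmonic sum gives the logarithm
(`lintegral_freqProj_schrodinger_le`).

`V²` functions. Let `V` be the pulled-back function, and telescope `V(t)` along the right endpoints
of the dyadic intervals of length `T / 2ⁿ` containing `t`. Each increment is constant on a grid, so
the free estimate applies on every grid interval. The fourth powers of the increments sum to at most
the fourth power of the `V²` norm, since `ℓ² ⊂ ℓ⁴` (`lintegral_increment_le`). Below the finest
scale, Bernstein's inequality costs `|I|²` but gains the mesh (`lintegral_remainder_le`). About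
`ln(|I|² T)` scales make that remainder bounded, so at `T = 1` the total is of order
`(ln|I|)^{5/4}`, which suffices as `5/4 < β + 1/2`.

The third estimate combines this bound, with logarithms absorbed into powers, and Bernstein's
inequality alone when `|I|√T ≤ 1` (`L4norm_sq_freqProj_le`). -/

/-! ### Fourier transform and Fourier multipliers on `L²`. -/

/-- The inverse Fourier transform on `L²` is given by the integral on `L¹ ∩ L²`. -/
theorem fourierInv_toLp_ae_eq {G : ℝ → ℂ} (hG1 : Integrable G) (hG2 : MemLp G 2) :
    (𝓕⁻ (hG2.toLp G) : L2) =ᵐ[volume] 𝓕⁻ G := by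
  have hcont : Continuous (𝓕⁻ G) := by
    rw [Real.fourierInv_eq_fourier_comp_neg]
    exact VectorFourier.fourierIntegral_continuous Real.continuous_fourierChar
      (by exact continuous_inner) hG1.comp_neg
  refine ae_eq_of_integral_contDiff_smul_eq
    ((Lp.memLp (𝓕⁻ (hG2.toLp G) : L2)).locallyIntegrable (by norm_num))
    hcont.locallyIntegrable fun g g_smooth g_cpt => ?_
  have hg₁ : HasCompactSupport (Complex.ofRealCLM ∘ g) := g_cpt.comp_left rfl
  have hg₂ : ContDiff ℝ (⊤ : ℕ∞) (Complex.ofRealCLM ∘ g) := by fun_prop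
  set s := hg₁.toSchwartzMap hg₂ with hs
  have hsg : ∀ x, s x = (g x : ℂ) := fun x => by simp [hs]
  -- Both sides are tested against a real test function `g`, viewed as a Schwartz function `s`: the
  -- `L²` transform is the distributional one, and the multiplication formula moves the transform
  -- from `s` to `G`.
  have h1 := congrArg (fun T => T s) (Lp.fourierInv_toTemperedDistribution_eq (hG2.toLp G))
  simp only [TemperedDistribution.fourierInv_apply, Lp.toTemperedDistribution_apply] at h1
  have h2 : ∫ x, g x • (𝓕⁻ (hG2.toLp G) : L2) x =
      ∫ x, s x • (𝓕⁻ (hG2.toLp G) : L2) x := by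
    refine integral_congr_ae (Eventually.of_forall fun x => ?_)
    simp [hsg]
  rw [h2, ← h1]
  have h3 : ∫ x, (𝓕⁻ s) x • (hG2.toLp G) x = ∫ x, (𝓕⁻ (s : ℝ → ℂ)) x • G x := by
    refine integral_congr_ae ?_
    filter_upwards [hG2.coeFn_toLp] with x hx
    rw [hx, SchwartzMap.fourierInv_coe]
  rw [h3]
  have h4 := VectorFourier.integral_fourierIntegral_smul_eq_flip (𝕜 := ℝ) (e := Real.fourierChar)
    (μ := volume) (ν := volume) (L := -innerₗ ℝ) Real.continuous_fourierChar
    (by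
      have : Continuous fun p : ℝ × ℝ => -(p.2 * p.1) := by fun_prop
      simpa using this) s.integrable hG1
  have h5 : ((-innerₗ ℝ).flip : ℝ →ₗ[ℝ] ℝ →ₗ[ℝ] ℝ) = -innerₗ ℝ := by
    ext; simp
  rw [h5] at h4
  rw [show (𝓕⁻ (s : ℝ → ℂ)) = VectorFourier.fourierIntegral Real.fourierChar volume
    (-innerₗ ℝ) s from rfl, h4]
  refine integral_congr_ae (Eventually.of_forall fun x => ?_)
  simp only [hsg]
  rw [Complex.real_smul]
  rfl

theorem lintegral_enorm_sq (f : L2) : ∫⁻ x, ‖f x‖ₑ ^ 2 = ‖f‖ₑ ^ 2 := by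
  rw [Lp.enorm_def, eLpNorm_eq_lintegral_rpow_enorm_toReal (by norm_num) (by norm_num),
    ← ENNReal.rpow_natCast, ← ENNReal.rpow_mul]
  simp

/-- One half of Plancherel's theorem, for integrable functions. -/
theorem lintegral_enorm_fourierInv_sq_le {H : ℝ → ℂ} (hH : Integrable H) :
    ∫⁻ x, ‖(𝓕⁻ H) x‖ₑ ^ 2 ≤ ∫⁻ η, ‖H η‖ₑ ^ 2 := by
  by_cases hfin : ∫⁻ η, ‖H η‖ₑ ^ 2 = ∞
  · simp [hfin]
  have h2 : MemLp H 2 := by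
    refine ⟨hH.aestronglyMeasurable, ?_⟩
    rw [eLpNorm_lt_top_iff_lintegral_rpow_enorm_lt_top (by norm_num) (by norm_num)]
    simpa using lt_top_iff_ne_top.2 hfin
  calc ∫⁻ x, ‖(𝓕⁻ H) x‖ₑ ^ 2 = ∫⁻ x, ‖(𝓕⁻ (h2.toLp H) : L2) x‖ₑ ^ 2 := by
        refine lintegral_congr_ae ?_
        filter_upwards [fourierInv_toLp_ae_eq hH h2] with x hx
        rw [hx]
    _ = ∫⁻ x, ‖(h2.toLp H) x‖ₑ ^ 2 := by
        rw [lintegral_enorm_sq, lintegral_enorm_sq]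
        congr 1
        rw [← ofReal_norm, ← ofReal_norm]
        congr 1
        exact (Lp.fourierTransformₗᵢ ℝ ℂ).symm.norm_map _
    _ = ∫⁻ η, ‖H η‖ₑ ^ 2 := by
        refine lintegral_congr_ae ?_
        filter_upwards [h2.coeFn_toLp] with x hx
        rw [hx]
    _ ≤ _ := le_rfl

theorem fourier_fourierMul_ae_eq {m : ℝ → ℂ} (hm : Measurable m) (hb : ∀ ξ, ‖m ξ‖ ≤ 1) (f : L2) :
    (𝓕 (fourierMul m hm hb f) : L2) =ᵐ[volume] fun ζ => m (2 * Real.pi * ζ) * (𝓕 f : L2) ζ := by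
  rw [fourierMul, FourierTransform.fourier_fourierInv_eq]
  exact MemLp.coeFn_toLp _

theorem fourier_injective {f g : L2} (h : (𝓕 f : L2) =ᵐ[volume] (𝓕 g : L2)) : f = g :=
  (Lp.fourierTransformₗᵢ ℝ ℂ).injective (Lp.ext h)

theorem enorm_fourier (f : L2) : ‖(𝓕 f : L2)‖ₑ = ‖f‖ₑ := by
  rw [← ofReal_norm, ← ofReal_norm, Lp.norm_fourier_eq]

theorem fourier_sub (f g : L2) : (𝓕 (f - g) : L2) = 𝓕 f - 𝓕 g :=
  (Lp.fourierTransformₗᵢ ℝ ℂ).map_sub f g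

theorem fourierMul_sub {m : ℝ → ℂ} (hm : Measurable m) (hb : ∀ ξ, ‖m ξ‖ ≤ 1) (f g : L2) :
    fourierMul m hm hb (f - g) = fourierMul m hm hb f - fourierMul m hm hb g := by
  apply fourier_injective
  rw [fourier_sub (fourierMul m hm hb f)]
  have h := Lp.coeFn_sub (𝓕 f : L2) (𝓕 g)
  rw [← fourier_sub] at h
  filter_upwards [fourier_fourierMul_ae_eq hm hb (f - g), fourier_fourierMul_ae_eq hm hb f,
    fourier_fourierMul_ae_eq hm hb g, Lp.coeFn_sub (𝓕 (fourierMul m hm hb f) : L2)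
      (𝓕 (fourierMul m hm hb g)), h] with ζ h1 h2 h3 h4 h5
  rw [h1, h4, h5, Pi.sub_apply, Pi.sub_apply, h2, h3, mul_sub]

theorem fourierMul_fourierMul {m m' : ℝ → ℂ} (hm : Measurable m) (hb : ∀ ξ, ‖m ξ‖ ≤ 1)
    (hm' : Measurable m') (hb' : ∀ ξ, ‖m' ξ‖ ≤ 1) (f : L2) :
    (𝓕 (fourierMul m hm hb (fourierMul m' hm' hb' f)) : L2) =ᵐ[volume]
      fun ζ => m (2 * Real.pi * ζ) * (m' (2 * Real.pi * ζ) * (𝓕 f : L2) ζ) := by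
  filter_upwards [fourier_fourierMul_ae_eq hm hb (fourierMul m' hm' hb' f),
    fourier_fourierMul_ae_eq hm' hb' f] with ζ h1 h2
  rw [h1, h2]

theorem fourierMul_comm {m m' : ℝ → ℂ} (hm : Measurable m) (hb : ∀ ξ, ‖m ξ‖ ≤ 1)
    (hm' : Measurable m') (hb' : ∀ ξ, ‖m' ξ‖ ≤ 1) (f : L2) :
    fourierMul m hm hb (fourierMul m' hm' hb' f) = fourierMul m' hm' hb' (fourierMul m hm hb f) := by
  apply fourier_injective
  filter_upwards [fourierMul_fourierMul hm hb hm' hb' f, fourierMul_fourierMul hm' hb' hm hb f]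
    with ζ h1 h2
  rw [h1, h2]; ring

theorem schrodinger_schrodinger_neg (t : ℝ) (f : L2) : schrodinger t (schrodinger (-t) f) = f := by
  apply fourier_injective
  filter_upwards [fourierMul_fourierMul (measurable_schrodinger_symbol t)
    (norm_schrodinger_symbol_le t) (measurable_schrodinger_symbol (-t))
    (norm_schrodinger_symbol_le (-t)) f] with ζ h1
  rw [schrodinger, schrodinger, h1, ← mul_assoc, ← Complex.exp_add]
  simp

theorem unitProj_sub (k : ℤ) (f g : L2) : unitProj k (f - g) = unitProj k f - unitProj k g :=
  fourierMul_sub (measurable_indicator_symbol _ _) (norm_indicator_symbol_le _ _) f g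

theorem pullback_unitProj (u : ℝ → L2) (k : ℤ) :
    pullback (fun t => unitProj k (u t)) = fun t => unitProj k (pullback u t) := by
  ext1 t
  exact fourierMul_comm (measurable_schrodinger_symbol _) (norm_schrodinger_symbol_le _)
    (measurable_indicator_symbol _ _) (norm_indicator_symbol_le _ _) (u t)

theorem schrodinger_pullback (u : ℝ → L2) (t : ℝ) : schrodinger t (pullback u t) = u t :=
  schrodinger_schrodinger_neg t (u t)

/-! ### Exponential time weight and oscillatory integrals. -/

theorem integrable_exp_neg_abs_div {h : ℝ} (hh : 0 < h) (c : ℝ) :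
    Integrable fun t : ℝ => Real.exp (-|t - c| / h) := by
  have h0 : Integrable fun t : ℝ => Real.exp (-|t| / h) := by
    rw [← integrableOn_univ, ← Iic_union_Ioi (a := (0 : ℝ))]
    refine IntegrableOn.union ?_ ?_
    · refine (integrableOn_exp_mul_Iic (a := 1 / h) (by positivity) 0).congr_fun ?_ measurableSet_Iic
      intro t ht
      simp only [abs_of_nonpos (mem_Iic.1 ht)]
      congr 1; ring
    · refine (integrableOn_exp_mul_Ioi (a := -(1 / h)) (by simpa using hh) 0).congr_fun ?_
        measurableSet_Ioi
      intro t ht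
      simp only [abs_of_pos (mem_Ioi.1 ht)]
      congr 1; ring
  exact h0.comp_sub_right c

/-- Splitting at `0` gives two pure exponentials with rates `A` and `B`; the value is `1/A - 1/B =
(B - A)/(AB)`. -/
theorem integral_exp_neg_abs_div_mul_cexp {h : ℝ} (hh : 0 < h) (x : ℝ) :
    ∫ t : ℝ, (Real.exp (-|t| / h) : ℂ) * Complex.exp (((-(t * x) : ℝ) : ℂ) * Complex.I) =
      ((2 * h / (1 + h ^ 2 * x ^ 2) : ℝ) : ℂ) := by
  set A : ℂ := 1 / h - x * Complex.I with hA
  set B : ℂ := -(1 / h) - x * Complex.I with hB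
  have hAr : A.re = 1 / h := by simp [hA, ← Complex.ofReal_inv]
  have hBr : B.re = -(1 / h) := by simp [hB, ← Complex.ofReal_inv]
  have hAre : 0 < A.re := by rw [hAr]; positivity
  have hBre : B.re < 0 := by rw [hBr]; simpa using hh
  set f : ℝ → ℂ := fun t =>
    (Real.exp (-|t| / h) : ℂ) * Complex.exp (((-(t * x) : ℝ) : ℂ) * Complex.I) with hf
  have e1 : EqOn (fun t : ℝ => Complex.exp (A * t)) f (Iic 0) := by
    intro t ht
    simp only [hf, abs_of_nonpos (mem_Iic.1 ht)]
    rw [Complex.ofReal_exp, ← Complex.exp_add]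
    congr 1; rw [hA]; push_cast; ring
  have e2 : EqOn (fun t : ℝ => Complex.exp (B * t)) f (Ioi 0) := by
    intro t ht
    simp only [hf, abs_of_pos (mem_Ioi.1 ht)]
    rw [Complex.ofReal_exp, ← Complex.exp_add]
    congr 1; rw [hB]; push_cast; ring
  have i1 : IntegrableOn f (Iic 0) :=
    (integrableOn_exp_mul_complex_Iic hAre 0).congr_fun e1 measurableSet_Iic
  have i2 : IntegrableOn f (Ioi 0) :=
    (integrableOn_exp_mul_complex_Ioi hBre 0).congr_fun e2 measurableSet_Ioi
  rw [← intervalIntegral.integral_Iic_add_Ioi i1 i2,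
    ← setIntegral_congr_fun measurableSet_Iic e1, ← setIntegral_congr_fun measurableSet_Ioi e2,
    integral_exp_mul_complex_Iic hAre, integral_exp_mul_complex_Ioi hBre]
  have hA0 : A ≠ 0 := fun h0 => by simp [h0] at hAre
  have hB0 : B ≠ 0 := fun h0 => by simp [h0] at hBre
  have hhc : (h : ℂ) ≠ 0 := by exact_mod_cast hh.ne'
  have hD : (1 + (h : ℂ) ^ 2 * (x : ℂ) ^ 2) ≠ 0 := by
    have : (1 + h ^ 2 * x ^ 2 : ℝ) ≠ 0 := by positivity
    exact_mod_cast this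
  have hAB : A * B * (h : ℂ) ^ 2 = -(1 + (h : ℂ) ^ 2 * (x : ℂ) ^ 2) := by
    rw [hA, hB]
    field_simp
    ring_nf
    simp only [Complex.I_sq]
    ring
  have hAB' : B - A = -2 / h := by rw [hA, hB]; ring
  push_cast
  simp only [mul_zero, Complex.exp_zero]
  rw [eq_div_iff hD]
  have h1 : (1 / A + -1 / B : ℂ) = (B - A) / (A * B) := by field_simp; ring
  rw [h1, hAB', ← neg_eq_iff_eq_neg.2 hAB]
  field_simp

theorem norm_integral_exp_neg_abs_sub_div_mul_cexp {h : ℝ} (hh : 0 < h) (c x : ℝ) :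
    ‖∫ t : ℝ, (Real.exp (-|t - c| / h) : ℂ) *
      Complex.exp (((-(t * x) : ℝ) : ℂ) * Complex.I)‖ = 2 * h / (1 + h ^ 2 * x ^ 2) := by
  have h1 : ∀ t : ℝ, (Real.exp (-|t - c| / h) : ℂ) *
      Complex.exp (((-(t * x) : ℝ) : ℂ) * Complex.I) =
      Complex.exp (((-(c * x) : ℝ) : ℂ) * Complex.I) * ((Real.exp (-|t - c| / h) : ℂ) *
        Complex.exp (((-((t - c) * x) : ℝ) : ℂ) * Complex.I)) := fun t => by
    rw [mul_left_comm, ← Complex.exp_add]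
    congr 2; push_cast; ring
  simp_rw [h1]
  rw [integral_const_mul, integral_sub_right_eq_self (fun t : ℝ => (Real.exp (-|t| / h) : ℂ) *
    Complex.exp (((-(t * x) : ℝ) : ℂ) * Complex.I)) c, integral_exp_neg_abs_div_mul_cexp hh,
    norm_mul, Complex.norm_exp_ofReal_mul_I, one_mul, Complex.norm_real, Real.norm_of_nonneg]
  positivity

/-- An `L²` bound on a time interval of length `h` for an oscillatory integral with phase
`t φ(ξ)`. -/
theorem lintegral_enorm_oscillatory_sq_le {p : ℝ → ℂ} (hp : Integrable p) {φ : ℝ → ℝ}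
    (hφ : Measurable φ) {h : ℝ} (hh : 0 < h) (c : ℝ) :
    ∫⁻ t in Icc c (c + h), ‖∫ ξ, Complex.exp (((-(t * φ ξ) : ℝ) : ℂ) * Complex.I) * p ξ‖ₑ ^ 2 ≤
      ENNReal.ofReal (Real.exp 1) * ∫⁻ ξ, ∫⁻ ξ', ‖p ξ‖ₑ * ‖p ξ'‖ₑ *
        ENNReal.ofReal (2 * h / (1 + h ^ 2 * (φ ξ - φ ξ') ^ 2)) := by
  -- On the window, `w ≥ 1/e`. Its Fourier transform has an absolutely integrable, explicit modulus,
  -- so expanding `|P|²` as a double integral and integrating in `t` first yields the Lorentzian.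
  set w : ℝ → ℝ := fun t => Real.exp (-|t - c| / h) with hw
  set P : ℝ → ℂ := fun t => ∫ ξ, Complex.exp (((-(t * φ ξ) : ℝ) : ℂ) * Complex.I) * p ξ with hP
  set pp : ℝ × ℝ → ℂ := fun q => p q.1 * (starRingEnd ℂ) (p q.2) with hpp
  have hpc : Integrable fun ξ => (starRingEnd ℂ) (p ξ) := by
    refine hp.norm.mono' (Complex.continuous_conj.comp_aestronglyMeasurable hp.1) ?_
    exact Eventually.of_forall fun ξ => by simp
  have hppi : Integrable pp (volume.prod volume) := hp.mul_prod hpc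
  have hwi : Integrable fun t => (w t : ℂ) := (integrable_exp_neg_abs_div hh c).ofReal
  set Ψ : ℝ × (ℝ × ℝ) → ℂ := fun z => Complex.exp (((-(z.1 * (φ z.2.1 - φ z.2.2)) : ℝ) : ℂ) *
    Complex.I) * ((w z.1 : ℂ) * pp z.2) with hΨ
  have hΨi : Integrable Ψ (volume.prod (volume.prod volume)) := by
    refine (hwi.mul_prod hppi).bdd_mul (c := 1) ?_ ?_
    · exact Measurable.aestronglyMeasurable (by fun_prop)
    · exact Eventually.of_forall fun z => (Complex.norm_exp_ofReal_mul_I _).le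
  have hsq : ∀ t, ∫ q, Ψ (t, q) ∂(volume.prod volume) = ((w t * ‖P t‖ ^ 2 : ℝ) : ℂ) := fun t => by
    have : ((w t * ‖P t‖ ^ 2 : ℝ) : ℂ) = (w t : ℂ) * (P t * (starRingEnd ℂ) (P t)) := by
      rw [Complex.mul_conj, Complex.normSq_eq_norm_sq]; push_cast; rfl
    rw [this, hP]
    simp only
    rw [← integral_conj, ← integral_prod_mul, ← integral_const_mul]
    refine integral_congr_ae (Eventually.of_forall fun q => ?_)
    simp only [hΨ, hpp, map_mul, ← Complex.exp_conj, Complex.conj_ofReal, Complex.conj_I]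
    have : Complex.exp (((-(t * (φ q.1 - φ q.2)) : ℝ) : ℂ) * Complex.I) =
        Complex.exp (((-(t * φ q.1) : ℝ) : ℂ) * Complex.I) *
          Complex.exp (((-(t * φ q.2) : ℝ) : ℂ) * -Complex.I) := by
      rw [← Complex.exp_add]; congr 1; push_cast; ring
    rw [this]; ring
  have hreal : Integrable fun t => w t * ‖P t‖ ^ 2 := by
    have := hΨi.integral_prod_left
    simp_rw [hsq] at this
    simpa only [RCLike.re_to_complex, Complex.ofReal_re] using this.re
  have hswap : ∫ t, ((w t * ‖P t‖ ^ 2 : ℝ) : ℂ) =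
      ∫ q, (∫ t, Ψ (t, q)) ∂(volume.prod volume) := by
    simp_rw [← hsq]
    exact integral_integral_swap hΨi
  have hK : ∀ q : ℝ × ℝ, ‖∫ t, Ψ (t, q)‖ₑ =
      ‖p q.1‖ₑ * ‖p q.2‖ₑ * ENNReal.ofReal (2 * h / (1 + h ^ 2 * (φ q.1 - φ q.2) ^ 2)) := fun q => by
    have : ∀ t, Ψ (t, q) = ((w t : ℂ) * Complex.exp (((-(t * (φ q.1 - φ q.2)) : ℝ) : ℂ) *
        Complex.I)) * pp q := fun t => by simp only [hΨ]; ring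
    simp_rw [this]
    rw [integral_mul_const, enorm_mul, ← ofReal_norm (∫ t, _),
      norm_integral_exp_neg_abs_sub_div_mul_cexp hh, mul_comm]
    simp [hpp]
  calc ∫⁻ t in Icc c (c + h), ‖P t‖ₑ ^ 2
      ≤ ∫⁻ t in Icc c (c + h), ENNReal.ofReal (Real.exp 1) * ENNReal.ofReal (w t * ‖P t‖ ^ 2) := by
        refine setLIntegral_mono' measurableSet_Icc fun t ht => ?_
        rw [← ENNReal.ofReal_mul (Real.exp_pos 1).le, ← ofReal_norm, ← ENNReal.ofReal_pow
          (norm_nonneg _)]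
        refine ENNReal.ofReal_le_ofReal ?_
        have : 1 ≤ Real.exp 1 * w t := by
          rw [hw, ← Real.exp_add]
          refine Real.one_le_exp ?_
          have : |t - c| / h ≤ 1 := by
            rw [div_le_one hh, abs_le]; constructor <;> linarith [ht.1, ht.2]
          rw [neg_div]; linarith
        nlinarith [sq_nonneg ‖P t‖]
    _ ≤ ∫⁻ t, ENNReal.ofReal (Real.exp 1) * ENNReal.ofReal (w t * ‖P t‖ ^ 2) :=
        setLIntegral_le_lintegral _ _
    _ = ENNReal.ofReal (Real.exp 1) * ENNReal.ofReal (∫ t, w t * ‖P t‖ ^ 2) := by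
        rw [lintegral_const_mul' _ _ ENNReal.ofReal_ne_top, ofReal_integral_eq_lintegral_ofReal hreal]
        exact Eventually.of_forall fun t => by positivity
    _ ≤ ENNReal.ofReal (Real.exp 1) * ‖∫ t, ((w t * ‖P t‖ ^ 2 : ℝ) : ℂ)‖ₑ := by
        gcongr
        rw [integral_complex_ofReal, ← ofReal_norm]
        refine ENNReal.ofReal_le_ofReal ?_
        simpa using le_abs_self _
    _ ≤ ENNReal.ofReal (Real.exp 1) * ∫⁻ q, ‖∫ t, Ψ (t, q)‖ₑ ∂(volume.prod volume) := by
        gcongr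
        rw [hswap]
        exact enorm_integral_le_lintegral_enorm _
    _ ≤ _ := by
        gcongr
        simp_rw [hK]
        exact lintegral_prod_le _

/-! ### Frequency cells and Schur's test. -/

/-- The interval of length `1 / r` consisting of the points `ζ` with `⌊r ζ⌋ = k`. -/
def cell (r : ℝ) (k : ℤ) : Set ℝ := {ζ | ⌊r * ζ⌋ = k}

theorem measurableSet_cell (r : ℝ) (k : ℤ) : MeasurableSet (cell r k) :=
  (Int.measurable_floor.comp (measurable_const_mul r)) (measurableSet_singleton k)

/-- The square of the `L²` norm on a cell. -/
def cellMass (r : ℝ) (F : ℝ → ℝ≥0∞) (k : ℤ) : ℝ≥0∞ := ∫⁻ ζ in cell r k, F ζ ^ 2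

theorem lintegral_eq_sum_cell (r : ℝ) {H : ℝ → ℝ≥0∞} {s : Finset ℤ}
    (hs : ∀ ζ, H ζ ≠ 0 → ⌊r * ζ⌋ ∈ s) : ∫⁻ ζ, H ζ = ∑ k ∈ s, ∫⁻ ζ in cell r k, H ζ := by
  rw [← lintegral_biUnion_finset (fun k _ l _ hkl => ?_) (fun k _ => measurableSet_cell r k)]
  · rw [setLIntegral_eq_of_support_subset]
    intro ζ hζ
    simp only [mem_iUnion]
    exact ⟨_, hs ζ hζ, rfl⟩
  · exact Set.disjoint_left.2 fun ζ h1 h2 => hkl (h1.symm.trans h2)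

theorem ennreal_mul_le_sq_add_sq (x y : ℝ≥0∞) : x * y ≤ x ^ 2 + y ^ 2 := by
  rcases le_total x y with h | h
  · calc x * y ≤ y * y := by gcongr
      _ ≤ x ^ 2 + y ^ 2 := by rw [← sq]; exact le_add_self
  · calc x * y ≤ x * x := by gcongr
      _ ≤ x ^ 2 + y ^ 2 := by rw [← sq]; exact le_self_add

theorem lintegral_mul_sq_le {α : Type*} [MeasurableSpace α] {μ : Measure α} {f g : α → ℝ≥0∞}
    (hf : AEMeasurable f μ) (hg : AEMeasurable g μ) :
    (∫⁻ x, f x * g x ∂μ) ^ 2 ≤ (∫⁻ x, f x ^ 2 ∂μ) * ∫⁻ x, g x ^ 2 ∂μ := by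
  have h := ENNReal.lintegral_mul_le_Lp_mul_Lq μ Real.HolderConjugate.two_two hf hg
  calc (∫⁻ x, f x * g x ∂μ) ^ 2 ≤ _ := pow_le_pow_left' h 2
    _ = _ := by
      rw [mul_pow, ← ENNReal.rpow_natCast, ← ENNReal.rpow_natCast, ← ENNReal.rpow_mul,
        ← ENNReal.rpow_mul]
      simp

/-- A cell translated by `m` has the length of a cell but need not be aligned with the grid, so it
is covered by two adjacent cells. -/
theorem setLIntegral_cell_comp_sub_sq_le (r : ℝ) {F : ℝ → ℝ≥0∞} (hF : Measurable F) (k : ℤ)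
    (m : ℝ) : ∫⁻ ξ in cell r k, F (ξ - m) ^ 2 ≤
      cellMass r F (k - ⌊r * m⌋) + cellMass r F (k - ⌊r * m⌋ - 1) := by
  set j := ⌊r * m⌋ with hj
  have e : ∀ l, cellMass r F l = ∫⁻ ξ, (cell r l).indicator (fun ζ => F ζ ^ 2) (ξ - m) := fun l => by
    rw [lintegral_sub_right_eq_self (fun ξ => (cell r l).indicator (fun ζ => F ζ ^ 2) ξ) m,
      lintegral_indicator (measurableSet_cell r l), cellMass]
  rw [e, e, ← lintegral_add_left, ← lintegral_indicator (measurableSet_cell r k)]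
  · refine lintegral_mono fun ξ => ?_
    by_cases hξ : ξ ∈ cell r k
    · rw [indicator_of_mem hξ]
      have h1 : ⌊r * ξ⌋ = k := hξ
      have h2 := Int.floor_eq_iff.1 h1
      have h3 := Int.floor_eq_iff.1 hj.symm
      have : ξ - m ∈ cell r (k - j) ∨ ξ - m ∈ cell r (k - j - 1) := by
        rcases le_or_gt ((k : ℝ) - j) (r * (ξ - m)) with h | h
        · left
          refine Int.floor_eq_iff.2 ⟨by push_cast; exact h, ?_⟩
          push_cast; rw [mul_sub]; linarith [h2.1, h2.2, h3.1, h3.2]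
        · right
          refine Int.floor_eq_iff.2 ⟨?_, by push_cast; linarith⟩
          push_cast; rw [mul_sub]; linarith [h2.1, h2.2, h3.1, h3.2]
      rcases this with h | h
      · rw [indicator_of_mem h]; exact le_self_add
      · rw [indicator_of_mem h]; exact le_add_self
    · rw [indicator_of_notMem hξ]; exact zero_le
  · exact ((hF.pow_const 2).indicator (measurableSet_cell r _)).comp (measurable_sub_const m)

theorem cellMass_eq_zero {r : ℝ} {F : ℝ → ℝ≥0∞} {s : Finset ℤ}
    (hs : ∀ ζ, F ζ ≠ 0 → ⌊r * ζ⌋ ∈ s) {k : ℤ} (hk : k ∉ s) : cellMass r F k = 0 := by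
  rw [cellMass, setLIntegral_congr_fun (measurableSet_cell r k) (g := fun _ => 0), lintegral_zero]
  intro ζ hζ
  by_contra h
  exact hk ((show ⌊r * ζ⌋ = k from hζ) ▸ hs ζ fun h0 => h (by simp [h0]))

/-- Cauchy–Schwarz on each cell bounds the integral by products of cell masses at `k` and at two
shifted indices. The sum of squares over all of `ℤ` does not see the shifts, so the bound is uniform
in `m`. -/
theorem sum_sq_setLIntegral_cell_mul_le {r : ℝ} {F : ℝ → ℝ≥0∞} (hF : Measurable F) {s : Finset ℤ}
    (hs : ∀ ζ, F ζ ≠ 0 → ⌊r * ζ⌋ ∈ s) (m : ℝ) :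
    ∑ k ∈ s, (∫⁻ ξ in cell r k, F ξ * F (ξ - m)) ^ 2 ≤ 4 * ∑ k ∈ s, cellMass r F k ^ 2 := by
  set A := cellMass r F with hA
  set j := ⌊r * m⌋
  have hS : ∑ k ∈ s, A k ^ 2 = ∑' k, A k ^ 2 :=
    (tsum_eq_sum fun k hk => by simp [hA, cellMass_eq_zero hs hk]).symm
  have hshift : ∀ i : ℤ, ∑' k, A (k - i) ^ 2 = ∑' k, A k ^ 2 := fun i =>
    (Equiv.subRight i).tsum_eq (fun k => A k ^ 2)
  calc ∑ k ∈ s, (∫⁻ ξ in cell r k, F ξ * F (ξ - m)) ^ 2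
      ≤ ∑ k ∈ s, (A k ^ 2 + A (k - j) ^ 2 + (A k ^ 2 + A (k - (j + 1)) ^ 2)) := by
        refine Finset.sum_le_sum fun k _ => ?_
        refine (lintegral_mul_sq_le hF.aemeasurable
          (hF.comp (measurable_sub_const m)).aemeasurable).trans ?_
        refine (mul_le_mul_right (setLIntegral_cell_comp_sub_sq_le r hF k m) _).trans ?_
        rw [mul_add, ← sub_sub]
        exact add_le_add (ennreal_mul_le_sq_add_sq _ _) (ennreal_mul_le_sq_add_sq _ _)
    _ ≤ ∑' k, (A k ^ 2 + A (k - j) ^ 2 + (A k ^ 2 + A (k - (j + 1)) ^ 2)) := ENNReal.sum_le_tsum s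
    _ = 4 * ∑ k ∈ s, A k ^ 2 := by
        rw [ENNReal.tsum_add, ENNReal.tsum_add, ENNReal.tsum_add, hshift, hshift, hS]
        ring

/-- Schur's test for a quadratic form with a kernel that is constant on pairs of cells. -/
theorem lintegral_lintegral_cell_kernel_le (r : ℝ) {G : ℝ → ℝ≥0∞} (hG : Measurable G) {a b : ℤ}
    (hs : ∀ ζ, G ζ ≠ 0 → ⌊r * ζ⌋ ∈ Finset.Icc a b) (K : ℤ → ℝ≥0∞) :
    ∫⁻ ξ, ∫⁻ y, G ξ * G y * K (⌊r * ξ⌋ - ⌊r * y⌋) ≤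
      2 * (∑ k ∈ Finset.Icc a b, (∫⁻ ξ in cell r k, G ξ) ^ 2) *
        ∑ d ∈ Finset.Icc (a - b) (b - a), K d := by
  set s := Finset.Icc a b
  set D := Finset.Icc (a - b) (b - a)
  set g : ℤ → ℝ≥0∞ := fun k => ∫⁻ ξ in cell r k, G ξ with hg
  have h1 : ∀ ξ, ∫⁻ y, G ξ * G y * K (⌊r * ξ⌋ - ⌊r * y⌋) =
      G ξ * ∑ l ∈ s, g l * K (⌊r * ξ⌋ - l) := fun ξ => by
    rw [lintegral_eq_sum_cell r (s := s), Finset.mul_sum]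
    · refine Finset.sum_congr rfl fun l _ => ?_
      rw [setLIntegral_congr_fun (measurableSet_cell r l)
        (g := fun y => (G ξ * K (⌊r * ξ⌋ - l)) * G y)]
      · rw [lintegral_const_mul _ hG]; simp only [hg]; ring
      · intro y hy
        simp only [show ⌊r * y⌋ = l from hy]; ring
    · intro y hy
      exact hs y fun h0 => hy (by simp [h0])
  have h2 : ∫⁻ ξ, ∫⁻ y, G ξ * G y * K (⌊r * ξ⌋ - ⌊r * y⌋) =
      ∑ k ∈ s, ∑ l ∈ s, g k * g l * K (k - l) := by
    simp_rw [h1]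
    rw [lintegral_eq_sum_cell r (s := s)]
    · refine Finset.sum_congr rfl fun k _ => ?_
      rw [setLIntegral_congr_fun (measurableSet_cell r k)
        (g := fun ξ => G ξ * ∑ l ∈ s, g l * K (k - l))]
      · rw [lintegral_mul_const _ hG, Finset.mul_sum]
        simp only [hg, mul_assoc]
      · intro ξ hξ
        simp only [show ⌊r * ξ⌋ = k from hξ]
    · intro ξ hξ
      exact hs ξ fun h0 => hξ (by simp [h0])
  have h3 : ∀ k ∈ s, ∑ l ∈ s, K (k - l) ≤ ∑ d ∈ D, K d := fun k hk => by
    rw [← Finset.sum_image (f := K) (g := fun l => k - l) (fun x _ y _ h => by simpa using h)]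
    refine Finset.sum_le_sum_of_subset fun d hd => ?_
    obtain ⟨l, hl, rfl⟩ := Finset.mem_image.1 hd
    rw [Finset.mem_Icc] at hk hl ⊢
    constructor <;> linarith [hk.1, hk.2, hl.1, hl.2]
  have h4 : ∀ l ∈ s, ∑ k ∈ s, K (k - l) ≤ ∑ d ∈ D, K d := fun l hl => by
    rw [← Finset.sum_image (f := K) (g := fun k => k - l) (fun x _ y _ h => by simpa using h)]
    refine Finset.sum_le_sum_of_subset fun d hd => ?_
    obtain ⟨k, hk, rfl⟩ := Finset.mem_image.1 hd
    rw [Finset.mem_Icc] at hk hl ⊢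
    constructor <;> linarith [hk.1, hk.2, hl.1, hl.2]
  rw [h2]
  calc ∑ k ∈ s, ∑ l ∈ s, g k * g l * K (k - l)
      ≤ ∑ k ∈ s, ∑ l ∈ s, (g k ^ 2 * K (k - l) + g l ^ 2 * K (k - l)) := by
        refine Finset.sum_le_sum fun k _ => Finset.sum_le_sum fun l _ => ?_
        rw [← add_mul]
        exact mul_le_mul_left (ennreal_mul_le_sq_add_sq _ _) _
    _ = ∑ k ∈ s, g k ^ 2 * ∑ l ∈ s, K (k - l) + ∑ l ∈ s, g l ^ 2 * ∑ k ∈ s, K (k - l) := by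
        simp_rw [Finset.sum_add_distrib, Finset.mul_sum]
        congr 1
        exact Finset.sum_comm
    _ ≤ ∑ k ∈ s, g k ^ 2 * ∑ d ∈ D, K d + ∑ l ∈ s, g l ^ 2 * ∑ d ∈ D, K d := by
        refine add_le_add (Finset.sum_le_sum fun k hk => ?_) (Finset.sum_le_sum fun k hk => ?_)
        · exact mul_le_mul_right (h3 k hk) _
        · exact mul_le_mul_right (h4 k hk) _
    _ = _ := by rw [← Finset.sum_mul]; ring

/-! ### The quadrilinear resonance form. -/

/-- The substitution is `ξ' = ξ - m`, `η = 2ξ - m - n`, after which the resonance function factors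
as `mn`. -/
theorem lintegral_resonance_change_variables {F κ : ℝ → ℝ≥0∞} (hF : Measurable F)
    (hκ : Measurable κ) :
    ∫⁻ η, ∫⁻ ξ, ∫⁻ ξ', F ξ * F (η - ξ) * (F ξ' * F (η - ξ')) * κ |(ξ - ξ') * (ξ + ξ' - η)| =
      ∫⁻ ξ, ∫⁻ m, ∫⁻ n, F ξ * F (ξ - m - n) * (F (ξ - m) * F (ξ - n)) * κ |m * n| := by
  rw [lintegral_lintegral_swap]
  swap
  · apply Measurable.aemeasurable
    apply Measurable.lintegral_prod_right' (f := fun z : (ℝ × ℝ) × ℝ =>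
      F z.1.2 * F (z.1.1 - z.1.2) * (F z.2 * F (z.1.1 - z.2)) *
        κ |(z.1.2 - z.2) * (z.1.2 + z.2 - z.1.1)|)
    fun_prop
  refine lintegral_congr fun ξ => ?_
  rw [lintegral_lintegral_swap]
  swap
  · apply Measurable.aemeasurable
    fun_prop
  rw [← lintegral_sub_left_eq_self _ ξ]
  refine lintegral_congr fun m => ?_
  rw [← lintegral_sub_left_eq_self _ (2 * ξ - m)]
  refine lintegral_congr fun n => ?_
  rw [show 2 * ξ - m - n - ξ = ξ - m - n by ring, show 2 * ξ - m - n - (ξ - m) = ξ - n by ring,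
    show (ξ - (ξ - m)) * (ξ + (ξ - m) - (2 * ξ - m - n)) = m * n by ring]

/-- The quadrilinear resonance form is controlled by the `ℓ²` sum of the cell masses squared. -/
theorem lintegral_resonance_le {r : ℝ} (hr : 0 < r) {F κ : ℝ → ℝ≥0∞} (hF : Measurable F)
    (hκ : Measurable κ) (hκ' : AntitoneOn κ (Ici 0)) {a b : ℤ}
    (hs : ∀ ζ, F ζ ≠ 0 → ⌊r * ζ⌋ ∈ Finset.Icc a b) :
    ∫⁻ η, ∫⁻ ξ, ∫⁻ ξ', F ξ * F (η - ξ) * (F ξ' * F (η - ξ')) * κ |(ξ - ξ') * (ξ + ξ' - η)| ≤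
      16 * (∑ k ∈ Finset.Icc a b, cellMass r F k ^ 2) *
        ∫⁻ m, ∑ d ∈ Finset.Icc (a - b) (b - a), κ (|m| * max |m| ((|(d : ℝ)| - 1) / r)) := by
  rw [lintegral_resonance_change_variables hF hκ]
  set Φ : ℝ → ℝ → ℝ → ℝ≥0∞ := fun ξ m n =>
    F ξ * F (ξ - m - n) * (F (ξ - m) * F (ξ - n)) * κ |m * n| with hΦ
  -- The form is symmetric in `m` and `n`, so restricting to `|m| ≤ |n|` costs a factor `2`. The
  -- final `16` is this `2`, times `2` from Schur's test, times `4` from the cell shifts.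
  set Θ : ℝ → ℝ → ℝ → ℝ≥0∞ := fun ξ m n =>
    {q : ℝ × ℝ | |q.1| ≤ |q.2|}.indicator (fun q => Φ ξ q.1 q.2) (m, n) with hΘ
  have hΦm : Measurable fun z : ℝ × ℝ × ℝ => Φ z.1 z.2.1 z.2.2 := by
    simp only [hΦ]; fun_prop
  have hΘm : Measurable fun z : ℝ × ℝ × ℝ => Θ z.1 z.2.1 z.2.2 := by
    have : (fun z : ℝ × ℝ × ℝ => Θ z.1 z.2.1 z.2.2) =
        {z : ℝ × ℝ × ℝ | |z.2.1| ≤ |z.2.2|}.indicator fun z => Φ z.1 z.2.1 z.2.2 := by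
      ext z; simp [hΘ, indicator]
    rw [this]
    exact hΦm.indicator (measurableSet_le (by fun_prop) (by fun_prop))
  have hsymm : ∀ ξ m n, Φ ξ m n = Φ ξ n m := fun ξ m n => by
    simp only [hΦ]
    rw [mul_comm m n, show ξ - m - n = ξ - n - m by ring, mul_comm (F (ξ - m))]
  have hle : ∀ ξ m n, Φ ξ m n ≤ Θ ξ m n + Θ ξ n m := fun ξ m n => by
    rcases le_total |m| |n| with h | h
    · refine le_trans (le_of_eq ?_) le_self_add
      simp [hΘ, indicator, h]
    · refine le_trans (le_of_eq ?_) le_add_self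
      simp [hΘ, indicator, h, hsymm ξ m n]
  have hΘm' : ∀ ξ, Measurable fun q : ℝ × ℝ => Θ ξ q.1 q.2 := fun ξ =>
    hΘm.comp (measurable_const.prodMk measurable_id)
  have step1 : ∫⁻ ξ, ∫⁻ m, ∫⁻ n, Φ ξ m n ≤ 2 * ∫⁻ m, ∫⁻ ξ, ∫⁻ y, Θ ξ m (ξ - y) := by
    calc ∫⁻ ξ, ∫⁻ m, ∫⁻ n, Φ ξ m n
        ≤ ∫⁻ ξ, ∫⁻ m, ∫⁻ n, (Θ ξ m n + Θ ξ n m) :=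
          lintegral_mono fun ξ => lintegral_mono fun m => lintegral_mono fun n => hle ξ m n
      _ = ∫⁻ ξ, 2 * ∫⁻ m, ∫⁻ n, Θ ξ m n := by
          refine lintegral_congr fun ξ => ?_
          have e1 : ∀ m, ∫⁻ n, (Θ ξ m n + Θ ξ n m) = (∫⁻ n, Θ ξ m n) + ∫⁻ n, Θ ξ n m := fun m =>
            lintegral_add_left ((hΘm' ξ).comp (measurable_const.prodMk measurable_id)) _
          simp_rw [e1]
          rw [lintegral_add_left (hΘm' ξ).lintegral_prod_right', two_mul]
          congr 1
          exact lintegral_lintegral_swap (f := fun m n => Θ ξ n m)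
            ((hΘm' ξ).comp measurable_swap).aemeasurable
      _ = 2 * ∫⁻ ξ, ∫⁻ m, ∫⁻ n, Θ ξ m n :=
          lintegral_const_mul' _ _ (by norm_num)
      _ = 2 * ∫⁻ m, ∫⁻ ξ, ∫⁻ n, Θ ξ m n := by
          congr 1
          refine lintegral_lintegral_swap (Measurable.aemeasurable ?_)
          exact Measurable.lintegral_prod_right' (f := fun z : (ℝ × ℝ) × ℝ => Θ z.1.1 z.1.2 z.2)
            (hΘm.comp (by fun_prop : Measurable fun z : (ℝ × ℝ) × ℝ => (z.1.1, z.1.2, z.2)))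
      _ = _ := by
          congr 1
          refine lintegral_congr fun m => lintegral_congr fun ξ => ?_
          exact (lintegral_sub_left_eq_self (fun n => Θ ξ m n) ξ).symm
  have step2 : ∀ m, ∫⁻ ξ, ∫⁻ y, Θ ξ m (ξ - y) ≤ 8 * (∑ k ∈ Finset.Icc a b, cellMass r F k ^ 2) *
      ∑ d ∈ Finset.Icc (a - b) (b - a), κ (|m| * max |m| ((|(d : ℝ)| - 1) / r)) := fun m => by
    -- With `y = ξ - n` the four factors pair up as `G ξ * G y`, and `|n| = |ξ - y|`.
    set G : ℝ → ℝ≥0∞ := fun ξ => F ξ * F (ξ - m) with hG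
    set K : ℤ → ℝ≥0∞ := fun d => κ (|m| * max |m| ((|(d : ℝ)| - 1) / r)) with hK
    have hGs : ∀ ζ, G ζ ≠ 0 → ⌊r * ζ⌋ ∈ Finset.Icc a b := fun ζ hζ =>
      hs ζ fun h0 => hζ (by simp [hG, h0])
    have hGm : Measurable G := hF.mul (hF.comp (measurable_sub_const m))
    calc ∫⁻ ξ, ∫⁻ y, Θ ξ m (ξ - y)
        ≤ ∫⁻ ξ, ∫⁻ y, G ξ * G y * K (⌊r * ξ⌋ - ⌊r * y⌋) := by
          refine lintegral_mono fun ξ => lintegral_mono fun y => ?_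
          by_cases h : |m| ≤ |ξ - y|
          · have e : Θ ξ m (ξ - y) = G ξ * G y * κ (|m| * |ξ - y|) := by
              simp only [hΘ, indicator, mem_ofPred_eq, h, if_true, hΦ, hG, abs_mul]
              rw [show ξ - m - (ξ - y) = y - m by ring, sub_sub_cancel]
              ring
            rw [e]
            refine mul_le_mul_right (hκ' ?_ ?_ ?_) _
            · exact mem_Ici.2 (by positivity)
            · exact mem_Ici.2 (by positivity)
            -- Points of cells at index distance `d` are at least `(|d| - 1)/r` apart; the
            -- restriction `|m| ≤ |ξ - y|` supplies the other entry of the maximum, which keeps the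
            -- near-diagonal kernel integrable in `m`.
            · refine mul_le_mul_of_nonneg_left (max_le h ?_) (abs_nonneg m)
              rw [div_le_iff₀ hr]
              have h1 := Int.floor_le (r * ξ)
              have h2 := Int.lt_floor_add_one (r * ξ)
              have h3 := Int.floor_le (r * y)
              have h4 := Int.lt_floor_add_one (r * y)
              have h5 : |ξ - y| * r = |r * ξ - r * y| := by
                rw [← mul_sub, abs_mul, abs_of_pos hr, mul_comm]
              rw [h5, sub_le_iff_le_add]
              push_cast
              rw [abs_le]
              constructor
              · linarith [neg_abs_le (r * ξ - r * y)]
              · linarith [le_abs_self (r * ξ - r * y)]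
          · simp [hΘ, indicator, h]
      _ ≤ _ := lintegral_lintegral_cell_kernel_le r hGm hGs K
      _ ≤ 2 * (4 * ∑ k ∈ Finset.Icc a b, cellMass r F k ^ 2) * _ := by
          gcongr
          exact sum_sq_setLIntegral_cell_mul_le hF hs m
      _ = _ := by ring
  calc _ ≤ 2 * ∫⁻ m, ∫⁻ ξ, ∫⁻ y, Θ ξ m (ξ - y) := step1
    _ ≤ 2 * ∫⁻ m, 8 * (∑ k ∈ Finset.Icc a b, cellMass r F k ^ 2) *
        ∑ d ∈ Finset.Icc (a - b) (b - a), κ (|m| * max |m| ((|(d : ℝ)| - 1) / r)) := by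
        gcongr with m
        exact step2 m
    _ = _ := by
        rw [lintegral_const_mul, ← mul_assoc, ← mul_assoc]
        · norm_num
        · fun_prop

/-! ### Integrals of the resonance kernel and the harmonic sum. -/

/-- The Fourier transform of the time weight, evaluated at the resonance function of the
Schrödinger equation. -/
def resonanceKernel (h x : ℝ) : ℝ≥0∞ :=
  ENNReal.ofReal (2 * h / (1 + h ^ 2 * (8 * Real.pi ^ 2 * x) ^ 2))

theorem measurable_resonanceKernel (h : ℝ) : Measurable (resonanceKernel h) := by
  unfold resonanceKernel; fun_prop

theorem antitoneOn_resonanceKernel {h : ℝ} (hh : 0 < h) :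
    AntitoneOn (resonanceKernel h) (Ici 0) := by
  intro x hx y hy hxy
  have : (0 : ℝ) ≤ x := hx
  unfold resonanceKernel
  gcongr

theorem lintegral_lorentzian {A B : ℝ} (hA : 0 ≤ A) (hB : 0 < B) :
    ∫⁻ m : ℝ, ENNReal.ofReal (A / (1 + (B * m) ^ 2)) = ENNReal.ofReal (A * Real.pi / B) := by
  have hi : Integrable fun m : ℝ => A / (1 + (B * m) ^ 2) := by
    simpa [div_eq_mul_inv] using (integrable_inv_one_add_sq.comp_mul_left' hB.ne').const_mul A
  rw [← ofReal_integral_eq_lintegral_ofReal hi (Eventually.of_forall fun m => by positivity)]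
  congr 1
  simp_rw [div_eq_mul_inv]
  rw [integral_const_mul, Measure.integral_comp_mul_left (fun x : ℝ => (1 + x ^ 2)⁻¹),
    integral_univ_inv_one_add_sq, abs_of_pos (inv_pos.2 hB), smul_eq_mul]
  ring

/-- The bound for the contribution of cells at distance `j` to the resonance sum. -/
def resonanceBound (h : ℝ) : ℕ → ℝ
  | 0 => 4 * Real.pi * √h
  | 1 => 4 * Real.pi * √h
  | j + 2 => ((j + 1 : ℕ) : ℝ)⁻¹

theorem resonanceBound_nonneg (h : ℝ) (j : ℕ) : 0 ≤ resonanceBound h j := by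
  rcases j with _ | _ | j <;> simp only [resonanceBound] <;> positivity

/-- Since the argument is at least `m²`, the kernel decays at scale `|m| ~ h^{-1/2}` and has height
`2h`. The inequality `1 + s ≤ 2(1 + s²)` compares it with a Lorentzian in `√h m`. -/
theorem lintegral_resonanceKernel_near_le {h : ℝ} (hh : 0 < h) (x : ℝ) :
    ∫⁻ m, resonanceKernel h (|m| * max |m| x) ≤ ENNReal.ofReal (4 * Real.pi * √h) := by
  have hs : 0 < √h := Real.sqrt_pos.2 hh
  have e : 4 * Real.pi * √h = 4 * h * Real.pi / √h := by
    rw [eq_div_iff hs.ne', mul_assoc, Real.mul_self_sqrt hh.le]; ring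
  rw [e, ← lintegral_lorentzian (by positivity) hs]
  refine lintegral_mono fun m => ENNReal.ofReal_le_ofReal ?_
  rw [mul_pow (√h), Real.sq_sqrt hh.le, div_le_div_iff₀ (by positivity) (by positivity)]
  set y := |m| * max |m| x with hy
  have h1 : m ^ 2 ≤ y := by
    rw [← sq_abs, sq]; exact mul_le_mul_of_nonneg_left (le_max_left _ _) (abs_nonneg m)
  have h2 : (1 : ℝ) ≤ 8 * Real.pi ^ 2 := by nlinarith [Real.pi_gt_three]
  have h3 : m ^ 2 ≤ 8 * Real.pi ^ 2 * y := by nlinarith [sq_nonneg m]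
  have h4 : h * m ^ 2 ≤ h * (8 * Real.pi ^ 2 * y) := mul_le_mul_of_nonneg_left h3 hh.le
  have h5 : h ^ 2 * (8 * Real.pi ^ 2 * y) ^ 2 = (h * (8 * Real.pi ^ 2 * y)) ^ 2 := by ring
  rw [h5]
  nlinarith [sq_nonneg (h * (8 * Real.pi ^ 2 * y) - 1)]

/-- Here the argument is at least linear in `|m|`, and the resulting Lorentzian has integral
`1/(2e)`, independent of `h`. -/
theorem lintegral_resonanceKernel_far_le {h : ℝ} (hh : 0 < h) {e : ℝ} (he : 0 < e) :
    ∫⁻ m, resonanceKernel h (|m| * max |m| (e / (2 * Real.pi))) ≤ ENNReal.ofReal e⁻¹ := by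
  have hpi := Real.pi_pos
  have hB : 0 < h * (8 * Real.pi ^ 2 * (e / (2 * Real.pi))) := by positivity
  calc ∫⁻ m, resonanceKernel h (|m| * max |m| (e / (2 * Real.pi)))
      ≤ ∫⁻ m : ℝ, ENNReal.ofReal
          (2 * h / (1 + (h * (8 * Real.pi ^ 2 * (e / (2 * Real.pi))) * m) ^ 2)) := by
        refine lintegral_mono fun m => ?_
        refine (antitoneOn_resonanceKernel hh (a := |m| * (e / (2 * Real.pi))) ?_ ?_ ?_).trans ?_
        · exact mem_Ici.2 (by positivity)
        · exact mem_Ici.2 (by positivity)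
        · exact mul_le_mul_of_nonneg_left (le_max_right _ _) (abs_nonneg m)
        · refine ENNReal.ofReal_le_ofReal (le_of_eq ?_)
          congr 2
          rw [mul_pow (8 * Real.pi ^ 2), mul_pow |m|, sq_abs]
          ring
    _ = ENNReal.ofReal (2 * h * Real.pi / (h * (8 * Real.pi ^ 2 * (e / (2 * Real.pi))))) :=
        lintegral_lorentzian (by positivity) hB
    _ ≤ ENNReal.ofReal e⁻¹ := by
        refine ENNReal.ofReal_le_ofReal (le_of_eq_of_le (b := 2⁻¹ * e⁻¹) ?_ ?_)
        · field_simp; ring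
        · have := inv_pos.2 he
          linarith

theorem lintegral_resonanceKernel_le {h : ℝ} (hh : 0 < h) (d : ℤ) :
    ∫⁻ m, resonanceKernel h (|m| * max |m| ((|(d : ℝ)| - 1) / (2 * Real.pi))) ≤
      ENNReal.ofReal (resonanceBound h d.natAbs) := by
  rcases hj : d.natAbs with _ | _ | j
  · exact lintegral_resonanceKernel_near_le hh _
  · exact lintegral_resonanceKernel_near_le hh _
  · have : |(d : ℝ)| - 1 = ((j + 1 : ℕ) : ℝ) := by
      rw [← Int.cast_abs, Int.abs_eq_natAbs, hj]; push_cast; ring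
    rw [this]
    exact lintegral_resonanceKernel_far_le hh (by positivity)

/-- The far terms form a harmonic sum: this is the only source of the logarithm in the free
estimate. -/
theorem sum_range_resonanceBound_le (h : ℝ) (N : ℕ) :
    ∑ j ∈ Finset.range (N + 1), resonanceBound h j ≤ 8 * Real.pi * √h + 1 + Real.log N := by
  have hp : 0 ≤ Real.pi * √h := by positivity
  rcases N with _ | M
  · simp only [zero_add, Finset.sum_range_one, resonanceBound, Nat.cast_zero, Real.log_zero]
    linarith
  · rw [Finset.sum_range_succ', Finset.sum_range_succ']
    simp only [resonanceBound]
    have h1 := harmonic_le_one_add_log M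
    rw [harmonic] at h1
    push_cast at h1
    have h2 : Real.log M ≤ Real.log ((M + 1 : ℕ) : ℝ) := by
      rcases M with _ | M
      · simp
      · exact Real.log_le_log (by positivity) (by push_cast; linarith)
    push_cast at h2 ⊢
    linarith

theorem sum_Icc_natAbs_le {g : ℕ → ℝ} (hg : ∀ j, 0 ≤ g j) (N : ℕ) :
    ∑ d ∈ Finset.Icc (-(N : ℤ)) N, g d.natAbs ≤ 2 * ∑ j ∈ Finset.range (N + 1), g j := by
  set p := (Finset.range (N + 1)).image fun j : ℕ => (j : ℤ)
  set q := (Finset.range (N + 1)).image fun j : ℕ => -(j : ℤ)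
  have hsub : Finset.Icc (-(N : ℤ)) N ⊆ p ∪ q := fun d hd => by
    rw [Finset.mem_Icc] at hd
    simp only [p, q, Finset.mem_union, Finset.mem_image, Finset.mem_range]
    rcases Int.natAbs_eq d with h | h
    · exact Or.inl ⟨d.natAbs, by omega, h.symm⟩
    · exact Or.inr ⟨d.natAbs, by omega, h.symm⟩
  calc ∑ d ∈ Finset.Icc (-(N : ℤ)) N, g d.natAbs
      ≤ ∑ d ∈ p ∪ q, g d.natAbs := Finset.sum_le_sum_of_subset_of_nonneg hsub fun _ _ _ => hg _
    _ ≤ ∑ d ∈ p, g d.natAbs + ∑ d ∈ q, g d.natAbs := by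
        rw [← Finset.sum_union_inter]
        linarith [Finset.sum_nonneg fun d (_ : d ∈ p ∩ q) => hg d.natAbs]
    _ = _ := by
        rw [Finset.sum_image fun x _ y _ hxy => by simpa using hxy,
          Finset.sum_image fun x _ y _ hxy => by simpa using hxy]
        simp only [Int.natAbs_natCast, Int.natAbs_neg]
        ring

theorem lintegral_sum_resonanceKernel_le {h : ℝ} (hh : 0 < h) {a b : ℤ} (hab : a ≤ b) :
    ∫⁻ m, ∑ d ∈ Finset.Icc (a - b) (b - a),
        resonanceKernel h (|m| * max |m| ((|(d : ℝ)| - 1) / (2 * Real.pi))) ≤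
      ENNReal.ofReal (64 * (√h + 1 + Real.log ((b : ℝ) - a))) := by
  obtain ⟨N, hN⟩ := Int.eq_ofNat_of_zero_le (sub_nonneg.2 hab)
  have hN' : (b : ℝ) - a = N := by exact_mod_cast hN
  have hmeas := measurable_resonanceKernel h
  have hlog : 0 ≤ Real.log N := Real.log_natCast_nonneg N
  rw [lintegral_finsetSum _ fun d _ => by fun_prop]
  calc _ ≤ ∑ d ∈ Finset.Icc (a - b) (b - a), ENNReal.ofReal (resonanceBound h d.natAbs) :=
        Finset.sum_le_sum fun d _ => lintegral_resonanceKernel_le hh d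
    _ = ENNReal.ofReal (∑ d ∈ Finset.Icc (-(N : ℤ)) N, resonanceBound h d.natAbs) := by
        rw [ENNReal.ofReal_sum_of_nonneg fun d _ => resonanceBound_nonneg h _, ← neg_sub b a, hN]
    _ ≤ _ := by
        refine ENNReal.ofReal_le_ofReal ?_
        refine (sum_Icc_natAbs_le (resonanceBound_nonneg h) N).trans ?_
        rw [hN']
        have := sum_range_resonanceBound_le h N
        nlinarith [Real.pi_lt_four, Real.sqrt_nonneg h]

/-! ### `L⁴` estimates for the free evolution. -/

/-- The Fourier transform of `P_{[a,b]} f`. -/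
def localizedFourier (a b : ℝ) (f : L2) (ζ : ℝ) : ℂ :=
  (Icc a b).indicator (fun _ => (1 : ℂ)) (2 * Real.pi * ζ) * (𝓕 f : L2) ζ

/-- The Fourier transform of `P_{[a,b]} e^{it∂ₓ²} f`. -/
def evolvedFourier (a b : ℝ) (f : L2) (t ζ : ℝ) : ℂ :=
  Complex.exp (((-(t * (2 * Real.pi * ζ) ^ 2) : ℝ) : ℂ) * Complex.I) * localizedFourier a b f ζ

theorem measurable_localizedFourier (a b : ℝ) (f : L2) : Measurable (localizedFourier a b f) :=
  ((measurable_indicator_symbol a b).comp (measurable_const_mul _)).mul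
    (Lp.stronglyMeasurable _).measurable

theorem memLp_localizedFourier (a b : ℝ) (f : L2) : MemLp (localizedFourier a b f) 2 :=
  memLp_multiplier_mul _ (measurable_indicator_symbol a b) (norm_indicator_symbol_le a b) (𝓕 f)

theorem mem_Icc_of_localizedFourier_ne_zero {a b : ℝ} {f : L2} {ζ : ℝ}
    (h : localizedFourier a b f ζ ≠ 0) : 2 * Real.pi * ζ ∈ Icc a b := by
  by_contra h0
  exact h (by simp [localizedFourier, h0])

theorem integrable_localizedFourier (a b : ℝ) (f : L2) : Integrable (localizedFourier a b f) := by
  have hpi := Real.two_pi_pos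
  have hsub : Function.support (localizedFourier a b f) ⊆
      Icc (a / (2 * Real.pi)) (b / (2 * Real.pi)) := fun ζ hζ => by
    have := mem_Icc_of_localizedFourier_ne_zero hζ
    rw [mem_Icc, div_le_iff₀ hpi, le_div_iff₀ hpi, mul_comm ζ]
    exact this
  rw [← integrableOn_iff_integrable_of_support_subset hsub]
  exact ((memLp_localizedFourier a b f).restrict _).integrable (by norm_num)

theorem enorm_evolvedFourier (a b : ℝ) (f : L2) (t ζ : ℝ) :
    ‖evolvedFourier a b f t ζ‖ₑ = ‖localizedFourier a b f ζ‖ₑ := by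
  rw [evolvedFourier, enorm_mul, ← ofReal_norm, Complex.norm_exp_ofReal_mul_I, ENNReal.ofReal_one,
    one_mul]

theorem measurable_evolvedFourier (a b : ℝ) (f : L2) :
    Measurable fun q : ℝ × ℝ => evolvedFourier a b f q.1 q.2 := by
  have := measurable_localizedFourier a b f
  unfold evolvedFourier
  fun_prop

theorem integrable_evolvedFourier (a b : ℝ) (f : L2) (t : ℝ) :
    Integrable (evolvedFourier a b f t) := by
  refine (integrable_localizedFourier a b f).bdd_mul (c := 1) ?_ ?_
  · exact Measurable.aestronglyMeasurable (by fun_prop)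
  · exact Eventually.of_forall fun z => (Complex.norm_exp_ofReal_mul_I _).le

theorem memLp_evolvedFourier (a b : ℝ) (f : L2) (t : ℝ) : MemLp (evolvedFourier a b f t) 2 := by
  refine (memLp_localizedFourier a b f).of_le (integrable_evolvedFourier a b f t).1 ?_
  refine Eventually.of_forall fun ζ => ?_
  rw [evolvedFourier, norm_mul, Complex.norm_exp_ofReal_mul_I, one_mul]

/-- The localized free evolution as an absolutely convergent Fourier integral. -/
theorem freqProj_schrodinger_ae_eq (a b : ℝ) (f : L2) (t : ℝ) :
    (freqProj a b (schrodinger t f) : ℝ → ℂ) =ᵐ[volume] 𝓕⁻ (evolvedFourier a b f t) := by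
  refine EventuallyEq.trans ?_ (fourierInv_toLp_ae_eq (integrable_evolvedFourier a b f t)
    (memLp_evolvedFourier a b f t))
  refine EventuallyEq.of_eq ?_
  congr 2
  unfold freqProj fourierMul
  congr 1
  rw [MemLp.toLp_eq_toLp_iff]
  filter_upwards [fourier_fourierMul_ae_eq (measurable_schrodinger_symbol t)
    (norm_schrodinger_symbol_le t) f] with ζ h1
  rw [show (𝓕 (schrodinger t f) : L2) ζ = _ from h1, evolvedFourier, localizedFourier]
  ring

theorem measurable_lintegral_freqProj_schrodinger (a b : ℝ) (f : L2) :
    Measurable fun t => ∫⁻ x, ‖freqProj a b (schrodinger t f) x‖ₑ ^ 4 := by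
  have h1 : ∀ t, ∫⁻ x, ‖freqProj a b (schrodinger t f) x‖ₑ ^ 4 =
      ∫⁻ x, ‖(𝓕⁻ (evolvedFourier a b f t)) x‖ₑ ^ 4 := fun t => by
    refine lintegral_congr_ae ?_
    filter_upwards [freqProj_schrodinger_ae_eq a b f t] with x hx
    rw [hx]
  simp_rw [h1, Real.fourierInv_eq']
  have hm := measurable_evolvedFourier a b f
  have h2 : StronglyMeasurable fun q : (ℝ × ℝ) × ℝ =>
      Complex.exp (((2 * Real.pi * inner ℝ q.2 q.1.2 : ℝ) : ℂ) * Complex.I) •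
        evolvedFourier a b f q.1.1 q.2 := by
    have h3 : Measurable fun q : (ℝ × ℝ) × ℝ => evolvedFourier a b f q.1.1 q.2 :=
      hm.comp (by fun_prop : Measurable fun q : (ℝ × ℝ) × ℝ => (q.1.1, q.2))
    exact Measurable.stronglyMeasurable (by fun_prop)
  have h4 := (h2.integral_prod_right' (ν := volume)).measurable
  exact Measurable.lintegral_prod_right' (f := fun q : ℝ × ℝ => ‖∫ v : ℝ,
    Complex.exp (((2 * Real.pi * inner ℝ v q.2 : ℝ) : ℂ) * Complex.I) •
      evolvedFourier a b f q.1 v‖ₑ ^ 4) (by fun_prop)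

/-- With `r = 2π` the cell of index `k` is the half-open angular frequency interval `[k, k+1)`,
contained in the closed interval of the unit projection. -/
theorem cellMass_localizedFourier_le (a b : ℝ) (f : L2) (k : ℤ) :
    cellMass (2 * Real.pi) (fun ζ => ‖localizedFourier a b f ζ‖ₑ) k ≤ ‖unitProj k f‖ₑ ^ 2 := by
  rw [← enorm_fourier, ← lintegral_enorm_sq, cellMass,
    ← lintegral_indicator (measurableSet_cell _ _)]
  refine lintegral_mono_ae ?_
  filter_upwards [fourier_fourierMul_ae_eq (measurable_indicator_symbol (k : ℝ) (k + 1))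
    (norm_indicator_symbol_le (k : ℝ) (k + 1)) f] with ζ h1
  rw [show (𝓕 (unitProj k f) : L2) ζ = _ from h1]
  by_cases hζ : ζ ∈ cell (2 * Real.pi) k
  · have h2 := Int.floor_eq_iff.1 (show ⌊2 * Real.pi * ζ⌋ = k from hζ)
    rw [indicator_of_mem hζ, indicator_of_mem (show 2 * Real.pi * ζ ∈ Icc (k : ℝ) (k + 1) from
      ⟨h2.1, h2.2.le⟩), one_mul, localizedFourier]
    gcongr
    rw [enorm_mul]
    refine mul_le_of_le_one_left' ?_
    rw [← ofReal_norm]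
    exact ENNReal.ofReal_le_one.2 (norm_indicator_symbol_le _ _ _)
  · rw [indicator_of_notMem hζ]; exact zero_le

theorem floor_mem_Icc_of_localizedFourier_ne_zero {a b : ℤ} {f : L2} (ζ : ℝ)
    (h : ‖localizedFourier a b f ζ‖ₑ ≠ 0) : ⌊2 * Real.pi * ζ⌋ ∈ Finset.Icc a b := by
  have h1 := mem_Icc_of_localizedFourier_ne_zero (enorm_ne_zero.1 h)
  rw [Finset.mem_Icc]
  exact ⟨Int.le_floor.2 h1.1, by exact_mod_cast (Int.floor_le _).trans h1.2⟩

theorem sum_cellMass_sq_localizedFourier_le (a b : ℤ) (f : L2) :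
    ∑ k ∈ Finset.Icc a b,
        cellMass (2 * Real.pi) (fun ζ => ‖localizedFourier a b f ζ‖ₑ) k ^ 2 ≤
      ∑ k ∈ Finset.Icc a b, ‖unitProj k f‖ₑ ^ 4 := by
  refine Finset.sum_le_sum fun k _ => ?_
  calc _ ≤ (‖unitProj k f‖ₑ ^ 2) ^ 2 :=
        pow_le_pow_left' (cellMass_localizedFourier_le a b f k) 2
    _ = _ := by rw [← pow_mul]

/-- `L⁴` Plancherel: the `L⁴` norm is controlled by the `L²` norm of an autocorrelation. -/
theorem lintegral_enorm_fourierInv_pow_four_le {G : ℝ → ℂ} (hG : Integrable G) :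
    ∫⁻ x, ‖(𝓕⁻ G) x‖ₑ ^ 4 ≤ ∫⁻ η, ‖∫ ξ, G ξ * G (η - ξ)‖ₑ ^ 2 := by
  have hconv : Integrable (convolution G G (ContinuousLinearMap.mul ℂ ℂ) volume) :=
    hG.integrable_convolution _ hG
  calc ∫⁻ x, ‖(𝓕⁻ G) x‖ₑ ^ 4
      = ∫⁻ x, ‖(𝓕⁻ (convolution G G (ContinuousLinearMap.mul ℂ ℂ) volume)) x‖ₑ ^ 2 := by
        refine lintegral_congr fun x => ?_
        rw [Real.fourierInv_eq_fourier_neg, Real.fourierInv_eq_fourier_neg,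
          Real.fourier_mul_convolution_eq hG hG, enorm_mul]
        ring
    _ ≤ _ := lintegral_enorm_fourierInv_sq_le hconv

theorem evolvedFourier_mul_evolvedFourier (a b : ℝ) (f : L2) (t ξ η : ℝ) :
    evolvedFourier a b f t ξ * evolvedFourier a b f t (η - ξ) =
      Complex.exp (((-(t * ((2 * Real.pi * ξ) ^ 2 + (2 * Real.pi * (η - ξ)) ^ 2)) : ℝ) : ℂ) *
        Complex.I) * (localizedFourier a b f ξ * localizedFourier a b f (η - ξ)) := by
  simp only [evolvedFourier]
  rw [mul_mul_mul_comm, ← Complex.exp_add]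
  congr 2; push_cast; ring

/-- The `L⁴` Strichartz-type estimate with `ℓ⁴` summation over unit frequency intervals, for the
free evolution on a time interval of length `h`. -/
theorem lintegral_freqProj_schrodinger_le {a b : ℤ} (hab : a ≤ b) (f : L2) {h : ℝ} (hh : 0 < h)
    (c : ℝ) :
    ∫⁻ t in Icc c (c + h), ∫⁻ x, ‖freqProj a b (schrodinger t f) x‖ₑ ^ 4 ≤
      ENNReal.ofReal (4096 * (√h + 1 + Real.log ((b : ℝ) - a))) *
        ∑ k ∈ Finset.Icc a b, ‖unitProj k f‖ₑ ^ 4 := by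
  set g := localizedFourier a b f with hg
  set φ : ℝ → ℝ → ℝ := fun η ξ => (2 * Real.pi * ξ) ^ 2 + (2 * Real.pi * (η - ξ)) ^ 2 with hφ
  set p : ℝ → ℝ → ℂ := fun η ξ => g ξ * g (η - ξ) with hp
  have hgm : Measurable g := measurable_localizedFourier a b f
  have hlog : 0 ≤ Real.log ((b : ℝ) - a) := by
    have : (b : ℝ) - a = ((b - a : ℤ) : ℝ) := by push_cast; ring
    rw [this]; exact Real.log_intCast_nonneg _
  have hPm : Measurable fun q : ℝ × ℝ => ‖∫ ξ, Complex.exp (((-(q.1 * φ q.2 ξ) : ℝ) : ℂ) *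
      Complex.I) * p q.2 ξ‖ₑ ^ 2 := by
    have h2 : StronglyMeasurable fun q : (ℝ × ℝ) × ℝ =>
        Complex.exp (((-(q.1.1 * φ q.1.2 q.2) : ℝ) : ℂ) * Complex.I) * p q.1.2 q.2 := by
      simp only [hφ, hp]
      exact Measurable.stronglyMeasurable (by fun_prop)
    exact ((h2.integral_prod_right' (ν := volume)).measurable.enorm).pow_const 2
  calc ∫⁻ t in Icc c (c + h), ∫⁻ x, ‖freqProj a b (schrodinger t f) x‖ₑ ^ 4
      ≤ ∫⁻ t in Icc c (c + h), ∫⁻ η,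
          ‖∫ ξ, Complex.exp (((-(t * φ η ξ) : ℝ) : ℂ) * Complex.I) * p η ξ‖ₑ ^ 2 := by
        refine lintegral_mono fun t => ?_
        refine le_trans (le_of_eq ?_) ((lintegral_enorm_fourierInv_pow_four_le
          (integrable_evolvedFourier a b f t)).trans (le_of_eq ?_))
        · refine lintegral_congr_ae ?_
          filter_upwards [freqProj_schrodinger_ae_eq a b f t] with x hx
          rw [hx]
        · simp_rw [evolvedFourier_mul_evolvedFourier]
          rfl
    _ = ∫⁻ η, ∫⁻ t in Icc c (c + h),
          ‖∫ ξ, Complex.exp (((-(t * φ η ξ) : ℝ) : ℂ) * Complex.I) * p η ξ‖ₑ ^ 2 :=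
        lintegral_lintegral_swap hPm.aemeasurable
    _ ≤ ∫⁻ η, ENNReal.ofReal (Real.exp 1) * ∫⁻ ξ, ∫⁻ ξ', ‖p η ξ‖ₑ * ‖p η ξ'‖ₑ *
          ENNReal.ofReal (2 * h / (1 + h ^ 2 * (φ η ξ - φ η ξ') ^ 2)) := by
        have hi := integrable_localizedFourier a b f
        refine lintegral_mono_ae ?_
        -- For almost every `η` the product `g(ξ) g(η - ξ)` is integrable in `ξ`, as the oscillatory
        -- estimate requires.
        filter_upwards [hi.ae_convolution_exists (ContinuousLinearMap.mul ℂ ℂ) hi] with η hη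
        exact lintegral_enorm_oscillatory_sq_le hη (by simp only [hφ]; fun_prop) hh c
    _ = ENNReal.ofReal (Real.exp 1) * ∫⁻ η, ∫⁻ ξ, ∫⁻ ξ', ‖g ξ‖ₑ * ‖g (η - ξ)‖ₑ *
          (‖g ξ'‖ₑ * ‖g (η - ξ')‖ₑ) * resonanceKernel h |(ξ - ξ') * (ξ + ξ' - η)| := by
        rw [lintegral_const_mul' _ _ ENNReal.ofReal_ne_top]
        congr 1
        refine lintegral_congr fun η => lintegral_congr fun ξ => lintegral_congr fun ξ' => ?_
        simp only [hp, enorm_mul, resonanceKernel]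
        -- The phase difference is `φ η ξ - φ η ξ' = 8π²(ξ - ξ')(ξ + ξ' - η)`.
        congr 4
        rw [mul_pow _ |_|, sq_abs]
        simp only [hφ]
        ring
    _ ≤ ENNReal.ofReal (Real.exp 1) * (16 * (∑ k ∈ Finset.Icc a b, ‖unitProj k f‖ₑ ^ 4) *
          ENNReal.ofReal (64 * (√h + 1 + Real.log ((b : ℝ) - a)))) := by
        gcongr
        refine (lintegral_resonance_le Real.two_pi_pos hgm.enorm (measurable_resonanceKernel h)
          (antitoneOn_resonanceKernel hh) floor_mem_Icc_of_localizedFourier_ne_zero).trans ?_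
        exact mul_le_mul' (mul_le_mul' le_rfl (sum_cellMass_sq_localizedFourier_le a b f))
          (lintegral_sum_resonanceKernel_le hh hab)
    _ = ENNReal.ofReal (Real.exp 1 * 16 * (64 * (√h + 1 + Real.log ((b : ℝ) - a)))) *
          ∑ k ∈ Finset.Icc a b, ‖unitProj k f‖ₑ ^ 4 := by
        rw [ENNReal.ofReal_mul (p := Real.exp 1 * 16) (by positivity),
          ENNReal.ofReal_mul (p := Real.exp 1) (by positivity), ENNReal.ofReal_ofNat]
        ring
    _ ≤ _ := by
        refine mul_le_mul_left (ENNReal.ofReal_le_ofReal ?_) _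
        have he : Real.exp 1 ≤ 4 := by linarith [Real.exp_one_lt_d9]
        have : 0 ≤ √h + 1 + Real.log ((b : ℝ) - a) := by positivity
        nlinarith

theorem sq_sum_le_card_mul (s : Finset ℤ) (x : ℤ → ℝ≥0∞) :
    (∑ k ∈ s, x k) ^ 2 ≤ s.card * ∑ k ∈ s, x k ^ 2 := by
  have h := ENNReal.rpow_sum_le_const_mul_sum_rpow s x (p := 2) (by norm_num)
  norm_num at h
  exact_mod_cast h

/-- Bernstein's inequality in `L⁴`, with the `L²` norm split into unit frequency intervals. -/
theorem lintegral_freqProj_schrodinger_le_bernstein {a b : ℤ} (hab : a ≤ b) (f : L2) (t : ℝ) :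
    ∫⁻ x, ‖freqProj a b (schrodinger t f) x‖ₑ ^ 4 ≤
      ENNReal.ofReal (((b : ℝ) - a) * ((b : ℝ) - a + 1)) *
        ∑ k ∈ Finset.Icc a b, ‖unitProj k f‖ₑ ^ 4 := by
  set G := evolvedFourier a b f t with hG
  have hGi := integrable_evolvedFourier a b f t
  set M : ℝ≥0∞ := ∫⁻ ζ, ‖G ζ‖ₑ ^ 2 with hM
  set I : Set ℝ := Icc ((a : ℝ) / (2 * Real.pi)) (b / (2 * Real.pi)) with hI
  have hpi := Real.two_pi_pos
  have hab' : (0 : ℝ) ≤ (b : ℝ) - a := by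
    have : (a : ℝ) ≤ b := by exact_mod_cast hab
    linarith
  -- Cauchy–Schwarz on the frequency support controls `‖𝓕⁻ G‖_∞²` by `|I| M`. One more factor `M`
  -- comes from Plancherel, and `M²` loses the number `b - a + 1` of cells in passing to `ℓ⁴`.
  have hL1 : (∫⁻ ζ, ‖G ζ‖ₑ) ^ 2 ≤ ENNReal.ofReal ((b : ℝ) - a) * M := by
    have e : ∫⁻ ζ, ‖G ζ‖ₑ = ∫⁻ ζ in I, 1 * ‖G ζ‖ₑ := by
      simp only [one_mul]
      refine (setLIntegral_eq_of_support_subset fun ζ hζ => ?_).symm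
      have h0 : localizedFourier a b f ζ ≠ 0 := by
        rw [Function.mem_support, hG, enorm_evolvedFourier] at hζ
        exact enorm_ne_zero.1 hζ
      have := mem_Icc_of_localizedFourier_ne_zero h0
      rw [hI, mem_Icc, div_le_iff₀ hpi, le_div_iff₀ hpi, mul_comm ζ]
      exact this
    rw [e]
    refine (lintegral_mul_sq_le aemeasurable_const
      hGi.1.aemeasurable.enorm.restrict).trans ?_
    gcongr
    · simp only [one_pow, lintegral_const, one_mul, Measure.restrict_apply_univ, hI,
        Real.volume_Icc]
      refine ENNReal.ofReal_le_ofReal ?_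
      rw [← sub_div]
      exact div_le_self hab' (by linarith [Real.pi_gt_three])
    · exact setLIntegral_le_lintegral _ _
  have hsup : ∀ x, ‖(𝓕⁻ G) x‖ₑ ≤ ∫⁻ ζ, ‖G ζ‖ₑ := fun x => by
    rw [Real.fourierInv_eq]
    refine (enorm_integral_le_lintegral_enorm _).trans (le_of_eq ?_)
    refine lintegral_congr fun ζ => ?_
    rw [← ofReal_norm, Circle.norm_smul, ofReal_norm]
  have hMsum : M ^ 2 ≤ ENNReal.ofReal ((b : ℝ) - a + 1) *
      ∑ k ∈ Finset.Icc a b, ‖unitProj k f‖ₑ ^ 4 := by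
    have e : M = ∑ k ∈ Finset.Icc a b,
        cellMass (2 * Real.pi) (fun ζ => ‖localizedFourier a b f ζ‖ₑ) k := by
      simp only [hM, hG, enorm_evolvedFourier, cellMass]
      refine lintegral_eq_sum_cell _ fun ζ hζ => ?_
      exact floor_mem_Icc_of_localizedFourier_ne_zero (f := f) ζ fun h0 => hζ (by simp [h0])
    rw [e]
    refine (sq_sum_le_card_mul _ _).trans ?_
    refine mul_le_mul' (le_of_eq ?_) (sum_cellMass_sq_localizedFourier_le a b f)
    rw [Int.card_Icc, ← ENNReal.ofReal_natCast]
    congr 1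
    have : (((b + 1 - a).toNat : ℤ) : ℝ) = ((b + 1 - a : ℤ) : ℝ) := by
      rw [Int.toNat_of_nonneg (by linarith)]
    push_cast at this
    rw [this]; ring
  calc ∫⁻ x, ‖freqProj a b (schrodinger t f) x‖ₑ ^ 4
      = ∫⁻ x, ‖(𝓕⁻ G) x‖ₑ ^ 4 := by
        refine lintegral_congr_ae ?_
        filter_upwards [freqProj_schrodinger_ae_eq a b f t] with x hx
        rw [hx]
    _ ≤ ∫⁻ x, ENNReal.ofReal ((b : ℝ) - a) * M * ‖(𝓕⁻ G) x‖ₑ ^ 2 := by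
        refine lintegral_mono fun x => ?_
        rw [show 4 = 2 + 2 from rfl, pow_add]
        gcongr
        exact (pow_le_pow_left' (hsup x) 2).trans hL1
    _ ≤ ENNReal.ofReal ((b : ℝ) - a) * M * M := by
        rw [lintegral_const_mul']
        · gcongr
          exact lintegral_enorm_fourierInv_sq_le hGi
        · refine ENNReal.mul_ne_top ENNReal.ofReal_ne_top ?_
          have := (memLp_evolvedFourier a b f t).2
          rw [eLpNorm_lt_top_iff_lintegral_rpow_enorm_lt_top (by norm_num) (by norm_num)] at this
          simpa [hM] using this.ne
    _ = ENNReal.ofReal ((b : ℝ) - a) * M ^ 2 := by ring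
    _ ≤ ENNReal.ofReal ((b : ℝ) - a) * (ENNReal.ofReal ((b : ℝ) - a + 1) *
          ∑ k ∈ Finset.Icc a b, ‖unitProj k f‖ₑ ^ 4) := by gcongr
    _ = _ := by rw [ENNReal.ofReal_mul hab', mul_assoc]

/-! ### Increments of `V²` functions along grids. -/

theorem sum_enorm_sub_sq_le_vNorm_sq (v : ℝ → L2) {x : ℕ → ℝ} (hx : StrictMono x) (m : ℕ) :
    ∑ i ∈ Finset.range m, ‖v (x (i + 1)) - v (x i)‖ₑ ^ 2 + ‖v (x m)‖ₑ ^ 2 ≤ vNorm 2 v ^ 2 := by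
  -- The partition is `-∞ < x₀ < ⋯ < x_m < ∞`. The increment from `-∞` is discarded, while the last
  -- one equals `-v(x_m)` because `v(∞) = 0`; with `m = 0` this also bounds the norm at every time.
  set τ : ℕ → EReal := fun i => if i = 0 then ⊥ else if i = m + 2 then ⊤ else (x (i - 1) : EReal)
    with hτ
  have hmid : ∀ i ≤ m, τ (i + 1) = (x i : EReal) := fun i hi => by
    simp [hτ, show ¬ i = m + 1 by omega]
  have hlast : τ (m + 2) = ⊤ := by simp [hτ]
  have hzero : τ 0 = ⊥ := by simp [hτ]
  set t : Fin (m + 2 + 1) → EReal := fun i => τ i with ht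
  have htm : StrictMono t := by
    rw [Fin.strictMono_iff_lt_succ]
    intro i
    simp only [ht, Fin.val_castSucc, Fin.val_succ]
    rcases Nat.eq_zero_or_pos (i : ℕ) with h0 | h0
    · rw [h0, hzero, hmid 0 (by omega)]; exact EReal.bot_lt_coe _
    · obtain ⟨j, hj⟩ : ∃ j, (i : ℕ) = j + 1 := ⟨i - 1, by omega⟩
      have := i.2
      rw [hj, hmid j (by omega)]
      rcases Nat.lt_or_ge j m with hjm | hjm
      · rw [hmid (j + 1) (by omega), EReal.coe_lt_coe_iff]; exact hx (Nat.lt_succ_self j)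
      · rw [show j + 1 + 1 = m + 2 by omega, hlast]; exact EReal.coe_lt_top _
  have hE : ∀ i ≤ m, extendEReal v (τ (i + 1)) = v (x i) := fun i hi => by
    rw [hmid i hi]; simp [extendEReal]
  have hEl : extendEReal v (τ (m + 2)) = 0 := by rw [hlast]; simp [extendEReal]
  have h1 : (∑ k : Fin (m + 2), ‖extendEReal v (t k.succ) - extendEReal v (t k.castSucc)‖ₑ ^ (2 : ℝ))
      ^ (1 / 2 : ℝ) ≤ vNorm 2 v :=
    le_iSup_of_le (m + 2) (le_iSup_of_le t (le_iSup_of_le htm (le_iSup_of_le hzero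
      (le_iSup_of_le (by simpa [ht] using hlast) le_rfl))))
  have h2 := pow_le_pow_left' h1 2
  rw [← ENNReal.rpow_natCast, ← ENNReal.rpow_mul] at h2
  norm_num at h2
  refine le_trans ?_ h2
  have h3 : ∑ k : Fin (m + 2), ‖extendEReal v (t k.succ) - extendEReal v (t k.castSucc)‖ₑ ^ 2 =
      ∑ k ∈ Finset.range (m + 2), ‖extendEReal v (τ (k + 1)) - extendEReal v (τ k)‖ₑ ^ 2 := by
    rw [← Fin.sum_univ_eq_sum_range
      (fun k => ‖extendEReal v (τ (k + 1)) - extendEReal v (τ k)‖ₑ ^ 2)]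
    simp [ht]
  rw [h3, Finset.sum_range_succ, Finset.sum_range_succ']
  refine add_le_add (le_trans (Finset.sum_le_sum fun i hi => ?_) le_self_add) ?_
  · rw [Finset.mem_range] at hi
    rw [hE i (by omega), hE (i + 1) (by omega)]
  · rw [hEl, hE m le_rfl, zero_sub, enorm_neg]

theorem ennreal_sum_pow_four_le_sq_sum_sq {ι : Type*} (s : Finset ι) (y : ι → ℝ≥0∞) :
    ∑ i ∈ s, y i ^ 4 ≤ (∑ i ∈ s, y i ^ 2) ^ 2 := by
  rw [sq (∑ i ∈ s, y i ^ 2), Finset.sum_mul]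
  refine Finset.sum_le_sum fun i hi => ?_
  calc y i ^ 4 = y i ^ 2 * y i ^ 2 := by ring
    _ ≤ _ := by
      gcongr
      exact Finset.single_le_sum (f := fun i => y i ^ 2) (fun _ _ => zero_le) hi

theorem sum_enorm_sub_pow_four_le (v : ℝ → L2) {x : ℕ → ℝ} (hx : StrictMono x) (m : ℕ) :
    ∑ i ∈ Finset.range m, ‖v (x (i + 1)) - v (x i)‖ₑ ^ 4 ≤ vNorm 2 v ^ 4 :=
  calc _ ≤ (∑ i ∈ Finset.range m, ‖v (x (i + 1)) - v (x i)‖ₑ ^ 2) ^ 2 :=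
        ennreal_sum_pow_four_le_sq_sum_sq _ _
    _ ≤ (vNorm 2 v ^ 2) ^ 2 :=
        pow_le_pow_left' (le_self_add.trans (sum_enorm_sub_sq_le_vNorm_sq v hx m)) 2
    _ = _ := by rw [← pow_mul]

theorem enorm_pow_four_le (v : ℝ → L2) (t : ℝ) : ‖v t‖ₑ ^ 4 ≤ vNorm 2 v ^ 4 := by
  have hx : StrictMono fun i : ℕ => t + i := fun i j hij => by simpa using hij
  have h := pow_le_pow_left' (sum_enorm_sub_sq_le_vNorm_sq v hx 0) 2
  simpa [← pow_mul] using h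

/-- Passing from mesh `2h` to mesh `h`, the right endpoint is unchanged for odd `j` and moves by one
fine step for even `j`. The nonzero terms are thus among the consecutive increments of one grid. -/
theorem sum_dyadic_increments_le (v : ℝ → L2) {h : ℝ} (hh : 0 < h) (m : ℕ) :
    ∑ j ∈ Finset.range m, ‖v (((j : ℝ) + 1) * h) - v ((((j / 2 : ℕ) : ℝ) + 1) * (2 * h))‖ₑ ^ 4 ≤
      vNorm 2 v ^ 4 := by
  have hx : StrictMono fun i : ℕ => ((i : ℝ) + 1) * h := fun i j hij => by
    have : (i : ℝ) < j := by exact_mod_cast hij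
    show ((i : ℝ) + 1) * h < ((j : ℝ) + 1) * h
    gcongr
  refine le_trans (Finset.sum_le_sum fun j _ => ?_) (sum_enorm_sub_pow_four_le v hx m)
  rcases Nat.even_or_odd' j with ⟨i, rfl | rfl⟩
  · rw [Nat.mul_div_cancel_left i two_pos, ← enorm_neg, neg_sub]
    refine le_of_eq ?_
    congr 4
    push_cast; ring
  · rw [show (2 * i + 1) / 2 = i by omega,
      show (((2 * i + 1 : ℕ) : ℝ) + 1) * h = ((i : ℝ) + 1) * (2 * h) by push_cast; ring]
    simp

/-- For a fixed offset `s`, the points `s + jh` and `(j+1)h` interleave into one increasing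
sequence, of which only every other increment is used. -/
theorem sum_translated_increments_le (v : ℝ → L2) {h s : ℝ} (hs : s ∈ Ioo 0 h) (m : ℕ) :
    ∑ j ∈ Finset.range m, ‖v (s + j * h) - v (((j : ℝ) + 1) * h)‖ₑ ^ 4 ≤ vNorm 2 v ^ 4 := by
  set x : ℕ → ℝ := fun i => if i % 2 = 0 then s + ((i / 2 : ℕ) : ℝ) * h
    else (((i / 2 : ℕ) : ℝ) + 1) * h with hx
  have he : ∀ j : ℕ, x (2 * j) = s + j * h := fun j => by simp [hx]
  have ho : ∀ j : ℕ, x (2 * j + 1) = (j + 1) * h := fun j => by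
    simp only [hx, show (2 * j + 1) % 2 = 1 by omega, show (2 * j + 1) / 2 = j by omega]
    simp
  have hmono : StrictMono x := by
    refine strictMono_nat_of_lt_succ fun i => ?_
    rcases Nat.even_or_odd' i with ⟨j, rfl | rfl⟩
    · rw [he, ho]; linarith [hs.2]
    · rw [ho, show 2 * j + 1 + 1 = 2 * (j + 1) by ring, he]; push_cast; linarith [hs.1]
  calc ∑ j ∈ Finset.range m, ‖v (s + j * h) - v (((j : ℝ) + 1) * h)‖ₑ ^ 4
      = ∑ j ∈ Finset.range m, ‖v (x (2 * j + 1)) - v (x (2 * j))‖ₑ ^ 4 := by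
        refine Finset.sum_congr rfl fun j _ => ?_
        rw [he, ho, ← enorm_neg, neg_sub]
    _ = ∑ i ∈ (Finset.range m).image (2 * ·), ‖v (x (i + 1)) - v (x i)‖ₑ ^ 4 := by
        rw [Finset.sum_image fun i _ j _ hij => by simpa using hij]
    _ ≤ ∑ i ∈ Finset.range (2 * m), ‖v (x (i + 1)) - v (x i)‖ₑ ^ 4 := by
        refine Finset.sum_le_sum_of_subset fun i hi => ?_
        obtain ⟨j, hj, rfl⟩ := Finset.mem_image.1 hi
        simp only [Finset.mem_range] at hj ⊢
        omega
    _ ≤ _ := sum_enorm_sub_pow_four_le v hmono _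

theorem setLIntegral_Ico_le_sum (f : ℝ → ℝ≥0∞) {h : ℝ} (hh : 0 < h) (m : ℕ) :
    ∫⁻ t in Ico 0 (m * h), f t ≤
      ∑ j ∈ Finset.range m, ∫⁻ t in Ico ((j : ℝ) * h) ((j + 1) * h), f t := by
  induction m with
  | zero => simp
  | succ m ih =>
    rw [Finset.sum_range_succ, ← Ico_union_Ico_eq_Ico (b := (m : ℝ) * h) (by positivity)
      (by push_cast; gcongr; linarith)]
    refine (lintegral_union_le f _ _).trans (add_le_add ih (le_of_eq ?_))
    push_cast; rfl

theorem floor_div_eq_of_mem_Ico {h t : ℝ} (hh : 0 < h) {j : ℕ}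
    (ht : t ∈ Ico ((j : ℝ) * h) ((j + 1) * h)) : ⌊t / h⌋₊ = j := by
  have h1 : 0 ≤ (j : ℝ) * h := by positivity
  rw [Nat.floor_eq_iff (div_nonneg (h1.trans ht.1) hh.le), le_div_iff₀ hh, div_lt_iff₀ hh]
  exact ht

theorem setLIntegral_Ico_translate (f : ℝ → ℝ≥0∞) (c h : ℝ) :
    ∫⁻ t in Ico c (c + h), f t = ∫⁻ s in Ioo 0 h, f (s + c) := by
  rw [setLIntegral_congr (Ioo_ae_eq_Ico (a := (0 : ℝ)) (b := h)),
    ← (measurePreserving_add_right volume c).setLIntegral_comp_preimage_emb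
      (measurableEmbedding_addRight c)]
  congr 2
  ext s
  simp only [mem_preimage, mem_Ico]
  constructor <;> rintro ⟨h1, h2⟩ <;> constructor <;> linarith

/-- The lower integral is superadditive without measurability; this matters because `V` is not
assumed measurable in time here. -/
theorem sum_lintegral_le {α ι : Type*} [MeasurableSpace α] (μ : Measure α) (s : Finset ι)
    (f : ι → α → ℝ≥0∞) : ∑ j ∈ s, ∫⁻ x, f j x ∂μ ≤ ∫⁻ x, ∑ j ∈ s, f j x ∂μ := by
  classical
  induction s using Finset.induction_on with
  | empty => simp
  | insert i s hi ih =>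
    simp only [Finset.sum_insert hi]
    exact (add_le_add le_rfl ih).trans (le_lintegral_add _ _)

/-! ### Estimates on a grid: initial term, dyadic increments, remainder. -/

/-- A function that follows the free evolution on each interval of a grid of mesh `h`. -/
theorem lintegral_step_le {a b : ℤ} (hab : a ≤ b) (E : ℕ → L2) {h : ℝ} (hh : 0 < h) (m : ℕ) :
    ∫⁻ t in Ico 0 (m * h), ∫⁻ x, ‖freqProj a b (schrodinger t (E ⌊t / h⌋₊)) x‖ₑ ^ 4 ≤
      ENNReal.ofReal (4096 * (√h + 1 + Real.log ((b : ℝ) - a))) *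
        ∑ k ∈ Finset.Icc a b, ∑ j ∈ Finset.range m, ‖unitProj k (E j)‖ₑ ^ 4 := by
  refine (setLIntegral_Ico_le_sum _ hh m).trans ?_
  rw [Finset.sum_comm, Finset.mul_sum]
  refine Finset.sum_le_sum fun j _ => ?_
  calc ∫⁻ t in Ico ((j : ℝ) * h) ((j + 1) * h),
        ∫⁻ x, ‖freqProj a b (schrodinger t (E ⌊t / h⌋₊)) x‖ₑ ^ 4
      = ∫⁻ t in Ico ((j : ℝ) * h) ((j + 1) * h),
        ∫⁻ x, ‖freqProj a b (schrodinger t (E j)) x‖ₑ ^ 4 :=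
        setLIntegral_congr_fun measurableSet_Ico fun t ht => by
          simp only [floor_div_eq_of_mem_Ico hh ht]
    _ ≤ ∫⁻ t in Icc ((j : ℝ) * h) (j * h + h),
        ∫⁻ x, ‖freqProj a b (schrodinger t (E j)) x‖ₑ ^ 4 := by
        refine lintegral_mono_set ?_
        rw [add_mul, one_mul]
        exact Ico_subset_Icc_self
    _ ≤ _ := lintegral_freqProj_schrodinger_le hab (E j) hh _

theorem measurable_lintegral_step (a b : ℝ) (E : ℕ → L2) (h : ℝ) :
    Measurable fun t : ℝ => ∫⁻ x, ‖freqProj a b (schrodinger t (E ⌊t / h⌋₊)) x‖ₑ ^ 4 := by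
  have h1 : Measurable fun q : ℕ × ℝ => ∫⁻ x, ‖freqProj a b (schrodinger q.2 (E q.1)) x‖ₑ ^ 4 :=
    measurable_from_prod_countable_right fun j =>
      measurable_lintegral_freqProj_schrodinger a b (E j)
  have h2 : Measurable fun t : ℝ => (⌊t / h⌋₊, t) :=
    (Nat.measurable_floor.comp (measurable_id.div_const h)).prodMk measurable_id
  exact Measurable.comp (f := fun t : ℝ => (⌊t / h⌋₊, t)) h1 h2

/-- The sum of the fourth powers of the `V²` norms of the unit frequency pieces. -/
def vSum (a b : ℤ) (V : ℝ → L2) : ℝ≥0∞ :=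
  ∑ k ∈ Finset.Icc a b, vNorm 2 (fun t => unitProj k (V t)) ^ 4

theorem lintegral_initial_le {a b : ℤ} (hab : a ≤ b) (V : ℝ → L2) {T : ℝ} (hT : 0 < T) (s : ℝ) :
    ∫⁻ t in Ico 0 T, ∫⁻ x, ‖freqProj a b (schrodinger t (V s)) x‖ₑ ^ 4 ≤
      ENNReal.ofReal (4096 * (√T + 1 + Real.log ((b : ℝ) - a))) * vSum a b V := by
  have h := lintegral_step_le hab (fun _ => V s) hT 1
  simp only [Nat.cast_one, one_mul, Finset.range_one, Finset.sum_singleton] at h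
  refine h.trans ?_
  gcongr
  exact Finset.sum_le_sum fun k _ => enorm_pow_four_le (fun t => unitProj k (V t)) s

theorem lintegral_increment_le {a b : ℤ} (hab : a ≤ b) (V : ℝ → L2) {h : ℝ} (hh : 0 < h) (m : ℕ) :
    ∫⁻ t in Ico 0 (m * h), ∫⁻ x, ‖freqProj a b (schrodinger t
        (V (((⌊t / h⌋₊ : ℝ) + 1) * h) - V ((((⌊t / h⌋₊ / 2 : ℕ) : ℝ) + 1) * (2 * h)))) x‖ₑ ^ 4 ≤
      ENNReal.ofReal (4096 * (√h + 1 + Real.log ((b : ℝ) - a))) * vSum a b V := by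
  refine (lintegral_step_le hab (fun j => V (((j : ℝ) + 1) * h) -
    V ((((j / 2 : ℕ) : ℝ) + 1) * (2 * h))) hh m).trans ?_
  gcongr
  refine Finset.sum_le_sum fun k _ => ?_
  simp only [unitProj_sub]
  exact sum_dyadic_increments_le (fun t => unitProj k (V t)) hh m

/-- Bernstein's inequality is applied at each time. Parametrizing all grid intervals by a common
offset `s ∈ (0, h)`, the sum over intervals is controlled by the `V²` norms for each `s`, so
integration costs only `h` and not the total length `mh`. -/
theorem lintegral_remainder_le {a b : ℤ} (hab : a ≤ b) (V : ℝ → L2) {h : ℝ} (hh : 0 < h) (m : ℕ) :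
    ∫⁻ t in Ico 0 (m * h), ∫⁻ x, ‖freqProj a b (schrodinger t
        (V t - V (((⌊t / h⌋₊ : ℝ) + 1) * h))) x‖ₑ ^ 4 ≤
      ENNReal.ofReal (((b : ℝ) - a) * ((b : ℝ) - a + 1) * h) * vSum a b V := by
  have hab' : (0 : ℝ) ≤ (b : ℝ) - a := by
    have : (a : ℝ) ≤ b := by exact_mod_cast hab
    linarith
  set B := ENNReal.ofReal (((b : ℝ) - a) * ((b : ℝ) - a + 1)) with hB
  set W : ℕ → ℝ → ℝ≥0∞ := fun j s =>
    ∑ k ∈ Finset.Icc a b, ‖unitProj k (V (s + j * h)) - unitProj k (V (((j : ℝ) + 1) * h))‖ₑ ^ 4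
    with hW
  calc _ ≤ ∑ j ∈ Finset.range m, ∫⁻ s in Ioo 0 h, B * W j s := by
        refine (setLIntegral_Ico_le_sum _ hh m).trans (Finset.sum_le_sum fun j _ => ?_)
        rw [add_mul, one_mul, setLIntegral_Ico_translate]
        refine setLIntegral_mono' measurableSet_Ioo fun s hs => ?_
        have hfl : ⌊(s + j * h) / h⌋₊ = j :=
          floor_div_eq_of_mem_Ico hh ⟨by linarith [hs.1], by linarith [hs.2]⟩
        rw [hfl]
        refine (lintegral_freqProj_schrodinger_le_bernstein hab _ _).trans ?_
        simp only [unitProj_sub, hW, hB]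
        exact le_rfl
    _ ≤ ∫⁻ s in Ioo 0 h, ∑ j ∈ Finset.range m, B * W j s := sum_lintegral_le _ _ _
    _ ≤ ∫⁻ s in Ioo 0 h, B * vSum a b V := by
        refine setLIntegral_mono' measurableSet_Ioo fun s hs => ?_
        rw [← Finset.mul_sum, hW, Finset.sum_comm]
        gcongr
        exact Finset.sum_le_sum fun k _ =>
          sum_translated_increments_le (fun t => unitProj k (V t)) hs m
    _ = _ := by
        rw [lintegral_const, Measure.restrict_apply_univ, Real.volume_Ioo, sub_zero,
          ENNReal.ofReal_mul (by positivity)]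
        ring

/-! ### Dyadic telescoping in time. -/

/-- The `L⁴` norm of an element of `L²(ℝ)`. -/
def l4 (f : L2) : ℝ≥0∞ := (∫⁻ x, ‖f x‖ₑ ^ 4) ^ (1 / 4 : ℝ)

theorem ennreal_rpow_inv_four_pow_four (x : ℝ≥0∞) : (x ^ (1 / 4 : ℝ)) ^ 4 = x := by
  rw [← ENNReal.rpow_natCast, ← ENNReal.rpow_mul]; norm_num

theorem l4_eq_eLpNorm (f : L2) : l4 f = eLpNorm f 4 volume := by
  rw [l4, eLpNorm_eq_lintegral_rpow_enorm_toReal (by norm_num) (by norm_num)]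
  simp only [ENNReal.toReal_ofNat]
  congr 2
  ext x
  exact_mod_cast rfl

theorem l4_add_le (f g : L2) : l4 (f + g) ≤ l4 f + l4 g := by
  simp only [l4_eq_eLpNorm]
  rw [eLpNorm_congr_ae (Lp.coeFn_add f g)]
  exact eLpNorm_add_le (Lp.aestronglyMeasurable f) (Lp.aestronglyMeasurable g) (by norm_num)

theorem l4_sum_le (n : ℕ) (f : ℕ → L2) :
    l4 (∑ i ∈ Finset.range n, f i) ≤ ∑ i ∈ Finset.range n, l4 (f i) := by
  induction n with
  | zero =>
    simp only [Finset.range_zero, Finset.sum_empty, l4_eq_eLpNorm]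
    rw [eLpNorm_congr_ae (Lp.coeFn_zero ℂ 2 volume)]
    simp
  | succ n ih =>
    rw [Finset.sum_range_succ, Finset.sum_range_succ]
    exact (l4_add_le _ _).trans (add_le_add ih le_rfl)

theorem freqProj_schrodinger_sub (a b t : ℝ) (f g : L2) :
    freqProj a b (schrodinger t (f - g)) =
      freqProj a b (schrodinger t f) - freqProj a b (schrodinger t g) := by
  have h1 : schrodinger t (f - g) = schrodinger t f - schrodinger t g :=
    fourierMul_sub (measurable_schrodinger_symbol t) (norm_schrodinger_symbol_le t) f g
  rw [h1]
  exact fourierMul_sub (measurable_indicator_symbol _ _) (norm_indicator_symbol_le _ _) _ _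

/-- Telescoping along a sequence of sample points. -/
theorem l4_freqProj_schrodinger_le_telescope (a b t : ℝ) (f : L2) (y : ℕ → L2) (L : ℕ) :
    l4 (freqProj a b (schrodinger t f)) ≤
      (l4 (freqProj a b (schrodinger t (y 0))) +
        ∑ n ∈ Finset.range L, l4 (freqProj a b (schrodinger t (y (n + 1) - y n)))) +
      l4 (freqProj a b (schrodinger t (f - y L))) := by
  set W : L2 → L2 := fun f => freqProj a b (schrodinger t f) with hW
  have hsub : ∀ f g, W (f - g) = W f - W g := freqProj_schrodinger_sub a b t
  have h1 : W f = (W (y 0) + ∑ n ∈ Finset.range L, W (y (n + 1) - y n)) + W (f - y L) := by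
    simp only [hsub]
    rw [Finset.sum_range_sub fun n => W (y n)]
    abel
  change l4 (W f) ≤ (l4 (W (y 0)) + ∑ n ∈ Finset.range L, l4 (W (y (n + 1) - y n))) +
    l4 (W (f - y L))
  rw [h1]
  exact (l4_add_le _ _).trans (add_le_add ((l4_add_le _ _).trans
    (add_le_add le_rfl (l4_sum_le L fun n => W (y (n + 1) - y n)))) le_rfl)

theorem ennreal_add_pow_four_le (x y : ℝ≥0∞) : (x + y) ^ 4 ≤ 16 * (x ^ 4 + y ^ 4) := by
  rcases le_total x y with h | h
  · calc (x + y) ^ 4 ≤ (y + y) ^ 4 := by gcongr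
      _ = 16 * y ^ 4 := by ring
      _ ≤ _ := by gcongr; exact le_add_self
  · calc (x + y) ^ 4 ≤ (x + x) ^ 4 := by gcongr
      _ = 16 * x ^ 4 := by ring
      _ ≤ _ := by gcongr; exact le_self_add

theorem lintegral_pow_four_add_le {α : Type*} [MeasurableSpace α] {μ : Measure α}
    {f g : α → ℝ≥0∞} (hf : AEMeasurable f μ) (hg : AEMeasurable g μ) :
    (∫⁻ x, (f x + g x) ^ 4 ∂μ) ^ (1 / 4 : ℝ) ≤
      (∫⁻ x, f x ^ 4 ∂μ) ^ (1 / 4 : ℝ) + (∫⁻ x, g x ^ 4 ∂μ) ^ (1 / 4 : ℝ) := by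
  have h := ENNReal.lintegral_Lp_add_le hf hg (p := (4 : ℕ)) (by norm_num)
  simp only [Pi.add_apply, ENNReal.rpow_natCast] at h
  simpa only [Nat.cast_ofNat] using h

theorem lintegral_pow_four_sum_le {α : Type*} [MeasurableSpace α] {μ : Measure α}
    {f : ℕ → α → ℝ≥0∞} (hf : ∀ n, Measurable (f n)) (L : ℕ) :
    (∫⁻ x, (∑ n ∈ Finset.range L, f n x) ^ 4 ∂μ) ^ (1 / 4 : ℝ) ≤
      ∑ n ∈ Finset.range L, (∫⁻ x, f n x ^ 4 ∂μ) ^ (1 / 4 : ℝ) := by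
  induction L with
  | zero => simp
  | succ L ih =>
    simp only [Finset.sum_range_succ]
    refine (lintegral_pow_four_add_le ?_ (hf L).aemeasurable).trans (add_le_add ih le_rfl)
    exact (Finset.measurable_sum _ fun n _ => hf n).aemeasurable

theorem L4norm_eq (T : ℝ) (u : ℝ → L2) :
    L4norm T u = (∫⁻ t in Ico 0 T, l4 (u t) ^ 4) ^ (1 / 4 : ℝ) := by
  rw [L4norm, setLIntegral_congr (Ico_ae_eq_Icc (a := (0 : ℝ)) (b := T))]
  simp only [l4, ennreal_rpow_inv_four_pow_four]

/-- The main estimate: free evolution on `L` dyadic scales, and Bernstein's inequality below the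
finest scale. -/
theorem L4norm_freqProj_le {a b : ℤ} (hab : a ≤ b) (u : ℝ → L2) {T : ℝ} (hT : 0 < T) (L : ℕ) :
    L4norm T (fun t => freqProj a b (u t)) ≤
      2 * (∑ n ∈ Finset.range (L + 1), ENNReal.ofReal
          (4096 * (√(T / 2 ^ n) + 1 + Real.log ((b : ℝ) - a))) ^ (1 / 4 : ℝ) +
        ENNReal.ofReal (((b : ℝ) - a) * ((b : ℝ) - a + 1) * (T / 2 ^ L)) ^ (1 / 4 : ℝ)) *
        vSum a b (pullback u) ^ (1 / 4 : ℝ) := by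
  set V := pullback u with hV
  set h : ℕ → ℝ := fun n => T / 2 ^ n with hh
  have hpos : ∀ n, 0 < h n := fun n => by positivity
  have hTn : ∀ n, ((2 ^ n : ℕ) : ℝ) * h n = T := fun n => by
    simp only [hh]; push_cast; field_simp
  have hsucc : ∀ n, h n = 2 * h (n + 1) := fun n => by
    simp only [hh, pow_succ]; field_simp
  -- For `t ≥ 0`, `τ n t` is the right endpoint of the half-open grid interval of mesh `T / 2 ^ n`
  -- containing `t`; on `[0, T)` the coarsest sample is the single point `T`.
  set τ : ℕ → ℝ → ℝ := fun n t => ((⌊t / h n⌋₊ : ℝ) + 1) * h n with hτ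
  have hτs : ∀ n t, τ n t = (((⌊t / h (n + 1)⌋₊ / 2 : ℕ) : ℝ) + 1) * (2 * h (n + 1)) :=
    fun n t => by
      have : t / h n = t / h (n + 1) / (2 : ℕ) := by
        rw [hsucc n, div_div, mul_comm]; norm_num
      simp only [hτ]
      rw [this, Nat.floor_div_natCast, ← hsucc]
  set A : ℕ → ℝ → ℝ≥0∞ := fun n t => l4 (freqProj a b (schrodinger t (V (τ (n + 1) t) - V (τ n t))))
    with hA
  set A0 : ℝ → ℝ≥0∞ := fun t => l4 (freqProj a b (schrodinger t (V (τ 0 t)))) with hA0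
  set R : ℝ → ℝ≥0∞ := fun t => l4 (freqProj a b (schrodinger t (V t - V (τ L t)))) with hR
  set β : ℕ → ℝ≥0∞ := fun n => ENNReal.ofReal (4096 * (√(h n) + 1 + Real.log ((b : ℝ) - a)))
    with hβ
  set S := vSum a b V with hS
  have hAm : ∀ n, Measurable (A n) := fun n => by
    have := measurable_lintegral_step a b (fun j => V (((j : ℝ) + 1) * h (n + 1)) -
      V ((((j / 2 : ℕ) : ℝ) + 1) * (2 * h (n + 1)))) (h (n + 1))
    simp only [hA, hτs n]
    exact this.pow_const _
  have hA0m : Measurable A0 :=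
    (measurable_lintegral_step a b (fun j => V (((j : ℝ) + 1) * h 0)) (h 0)).pow_const _
  have hAint : ∀ n, ∫⁻ t in Ico 0 T, A n t ^ 4 ≤ β (n + 1) * S := fun n => by
    have := lintegral_increment_le hab V (hpos (n + 1)) (2 ^ (n + 1))
    rw [hTn] at this
    simp only [hA, l4, ennreal_rpow_inv_four_pow_four, hτs n]
    exact this
  have hA0int : ∫⁻ t in Ico 0 T, A0 t ^ 4 ≤ β 0 * S := by
    have h0 : h 0 = T := by simp [hh]
    have := lintegral_initial_le hab V hT T
    simp only [hA0, l4, ennreal_rpow_inv_four_pow_four]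
    simp only [hβ, h0]
    refine le_trans (le_of_eq ?_) this
    refine setLIntegral_congr_fun measurableSet_Ico fun t ht => ?_
    have hfl : ⌊t / T⌋₊ = 0 := floor_div_eq_of_mem_Ico hT (by simpa using ht)
    simp only [hτ, h0, hfl]
    simp
  have hRint : ∫⁻ t in Ico 0 T, R t ^ 4 ≤
      ENNReal.ofReal (((b : ℝ) - a) * ((b : ℝ) - a + 1) * h L) * S := by
    have := lintegral_remainder_le hab V (hpos L) (2 ^ L)
    rw [hTn] at this
    simp only [hR, l4, ennreal_rpow_inv_four_pow_four]
    exact this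
  have hpt : ∀ t, l4 (freqProj a b (u t)) ≤ (A0 t + ∑ n ∈ Finset.range L, A n t) + R t := fun t => by
    have := l4_freqProj_schrodinger_le_telescope a b t (V t) (fun n => V (τ n t)) L
    rwa [hV, schrodinger_pullback] at this
  have hsum_m : Measurable fun t => ∑ n ∈ Finset.range L, A n t :=
    Finset.measurable_sum _ fun n _ => hAm n
  have hroot : ∀ {x y : ℝ≥0∞}, x ≤ y → x ^ (1 / 4 : ℝ) ≤ y ^ (1 / 4 : ℝ) := fun hxy =>
    ENNReal.rpow_le_rpow hxy (by norm_num)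
  have h16 : (16 : ℝ≥0∞) ^ (1 / 4 : ℝ) = 2 := by
    rw [show (16 : ℝ≥0∞) = 2 ^ (4 : ℝ) by norm_num, ← ENNReal.rpow_mul]; norm_num
  have hmain : (∫⁻ t in Ico 0 T, (A0 t + ∑ n ∈ Finset.range L, A n t) ^ 4) ^ (1 / 4 : ℝ) ≤
      ∑ n ∈ Finset.range (L + 1), β n ^ (1 / 4 : ℝ) * S ^ (1 / 4 : ℝ) := by
    refine (lintegral_pow_four_add_le hA0m.aemeasurable hsum_m.aemeasurable).trans ?_
    rw [Finset.sum_range_succ', add_comm]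
    refine add_le_add ((lintegral_pow_four_sum_le hAm L).trans
      (Finset.sum_le_sum fun n _ => ?_)) ?_
    · rw [← ENNReal.mul_rpow_of_nonneg _ _ (by norm_num)]
      exact hroot (hAint n)
    · rw [← ENNReal.mul_rpow_of_nonneg _ _ (by norm_num)]
      exact hroot hA0int
  -- The step terms are measurable and obey Minkowski's inequality, so the scales add without loss.
  -- The remainder need not be measurable, and is split off by the crude `(x + y)⁴ ≤ 16(x⁴ + y⁴)`,
  -- whence the factor `2 = 16^{1/4}`.
  calc L4norm T (fun t => freqProj a b (u t))
      ≤ (16 * (∫⁻ t in Ico 0 T, (A0 t + ∑ n ∈ Finset.range L, A n t) ^ 4) +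
          16 * ∫⁻ t in Ico 0 T, R t ^ 4) ^ (1 / 4 : ℝ) := by
        rw [L4norm_eq]
        refine hroot ?_
        rw [← mul_add, ← lintegral_add_left (f := fun t => (A0 t + ∑ n ∈ Finset.range L, A n t) ^ 4)
            ((hA0m.add hsum_m).pow_const 4),
          ← lintegral_const_mul' _ _ (by norm_num)]
        exact lintegral_mono fun t =>
          (pow_le_pow_left' (hpt t) 4).trans (ennreal_add_pow_four_le _ _)
    _ ≤ 2 * (∫⁻ t in Ico 0 T, (A0 t + ∑ n ∈ Finset.range L, A n t) ^ 4) ^ (1 / 4 : ℝ) +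
          2 * (∫⁻ t in Ico 0 T, R t ^ 4) ^ (1 / 4 : ℝ) := by
        refine (ENNReal.rpow_add_le_add_rpow _ _ (by norm_num) (by norm_num)).trans ?_
        rw [ENNReal.mul_rpow_of_nonneg _ _ (by norm_num),
          ENNReal.mul_rpow_of_nonneg _ _ (by norm_num), h16]
    _ ≤ 2 * (∑ n ∈ Finset.range (L + 1), β n ^ (1 / 4 : ℝ) * S ^ (1 / 4 : ℝ)) +
          2 * (ENNReal.ofReal (((b : ℝ) - a) * ((b : ℝ) - a + 1) * h L) ^ (1 / 4 : ℝ) *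
            S ^ (1 / 4 : ℝ)) := by
        rw [← ENNReal.mul_rpow_of_nonneg _ S (by norm_num)]
        gcongr
    _ = _ := by rw [← Finset.sum_mul]; ring

/-- Bernstein's inequality with the supremum over time in place of the variation; it is efficient
when `|I|√T ≤ 1`. -/
theorem L4norm_freqProj_le_bernstein {a b : ℤ} (hab : a ≤ b) (u : ℝ → L2) (T : ℝ) :
    L4norm T (fun t => freqProj a b (u t)) ≤
      ENNReal.ofReal (((b : ℝ) - a) * ((b : ℝ) - a + 1) * T) ^ (1 / 4 : ℝ) *
        vSum a b (pullback u) ^ (1 / 4 : ℝ) := by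
  have hab' : (0 : ℝ) ≤ (b : ℝ) - a := by
    have : (a : ℝ) ≤ b := by exact_mod_cast hab
    linarith
  rw [L4norm_eq, ← ENNReal.mul_rpow_of_nonneg _ _ (by norm_num)]
  refine ENNReal.rpow_le_rpow ?_ (by norm_num)
  simp only [l4, ennreal_rpow_inv_four_pow_four]
  calc ∫⁻ t in Ico 0 T, ∫⁻ x, ‖freqProj a b (u t) x‖ₑ ^ 4
      ≤ ∫⁻ t in Ico 0 T, ENNReal.ofReal (((b : ℝ) - a) * ((b : ℝ) - a + 1)) *
          vSum a b (pullback u) := by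
        refine lintegral_mono fun t => ?_
        have := lintegral_freqProj_schrodinger_le_bernstein hab (pullback u t) t
        rw [schrodinger_pullback] at this
        refine this.trans ?_
        gcongr
        exact Finset.sum_le_sum fun k _ => enorm_pow_four_le (fun t => unitProj k (pullback u t)) t
    _ = _ := by
        rw [lintegral_const, Measure.restrict_apply_univ, Real.volume_Ico, sub_zero,
          ENNReal.ofReal_mul (p := ((b : ℝ) - a) * ((b : ℝ) - a + 1)) (by positivity)]
        ring

/-! ### Choice of the number of scales and the final bounds. -/

theorem vSum_pullback (a b : ℤ) (u : ℝ → L2) : vSum a b (pullback u) =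
    ∑ k ∈ Finset.Icc a b, vDeltaNorm 2 (fun t => unitProj k (u t)) ^ 4 := by
  simp only [vSum, vDeltaNorm, pullback_unitProj]

theorem ofReal_rpow_inv_four_le {x y : ℝ} (hy : 0 ≤ y) (h : x ≤ y ^ 4) :
    ENNReal.ofReal x ^ (1 / 4 : ℝ) ≤ ENNReal.ofReal y := by
  calc ENNReal.ofReal x ^ (1 / 4 : ℝ) ≤ ENNReal.ofReal (y ^ 4) ^ (1 / 4 : ℝ) :=
        ENNReal.rpow_le_rpow (ENNReal.ofReal_le_ofReal h) (by norm_num)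
    _ = ENNReal.ofReal y := by
        rw [ENNReal.ofReal_pow hy, ← ENNReal.rpow_natCast, ← ENNReal.rpow_mul]; norm_num

theorem ofReal_mul_rpow_inv_four_sq {y : ℝ} (hy : 0 ≤ y) (S : ℝ≥0∞) :
    (ENNReal.ofReal y * S ^ (1 / 4 : ℝ)) ^ 2 = ENNReal.ofReal (y ^ 2) * S ^ (1 / 2 : ℝ) := by
  rw [mul_pow, ← ENNReal.ofReal_pow hy, ← ENNReal.rpow_natCast (S ^ (1 / 4 : ℝ)),
    ← ENNReal.rpow_mul]
  norm_num

theorem half_le_log {a b : ℤ} (hab : a + 2 ≤ b) : 1 / 2 ≤ Real.log ((b : ℝ) - a) := by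
  have h2 : (2 : ℝ) ≤ (b : ℝ) - a := by
    have : ((a + 2 : ℤ) : ℝ) ≤ b := by exact_mod_cast hab
    push_cast at this; linarith
  have := Real.log_le_log (by norm_num) h2
  linarith [Real.log_two_gt_d9]

/-- The kernel estimate yields the fourth root of `2 + ln|I|`, which is below the claimed square
root up to a constant because `ln|I| ≥ 1/2`. For `σ = -1`, time reflection moves the window to `[-1,
0]`. -/
theorem L4norm_one_schrodinger_le {a b : ℤ} (hab : a + 2 ≤ b) {σ : ℝ} (hσ : σ = 1 ∨ σ = -1)
    (f : L2) :
    L4norm 1 (fun t => freqProj a b (schrodinger (σ * t) f)) ≤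
      ENNReal.ofReal (16 * √(Real.log ((b : ℝ) - a))) *
        (∑ k ∈ Finset.Icc a b, ‖unitProj k f‖ₑ ^ 4) ^ (1 / 4 : ℝ) := by
  have hab' : a ≤ b := by omega
  have hlog := half_le_log hab
  set l := Real.log ((b : ℝ) - a)
  set g : ℝ → ℝ≥0∞ := fun t => ∫⁻ x, ‖freqProj a b (schrodinger t f) x‖ₑ ^ 4 with hg
  have key : ∫⁻ t in Icc 0 1, g (σ * t) ≤ ENNReal.ofReal (4096 * (√1 + 1 + l)) *
      ∑ k ∈ Finset.Icc a b, ‖unitProj k f‖ₑ ^ 4 := by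
    rcases hσ with rfl | rfl
    · simpa using lintegral_freqProj_schrodinger_le hab' f one_pos 0
    · have h1 := lintegral_freqProj_schrodinger_le hab' f one_pos (-1)
      refine le_trans (le_of_eq ?_) h1
      rw [← (Measure.measurePreserving_neg (volume : Measure ℝ)).setLIntegral_comp_preimage_emb
        (MeasurableEquiv.neg ℝ).measurableEmbedding]
      simp [hg]
  calc L4norm 1 (fun t => freqProj a b (schrodinger (σ * t) f))
      ≤ (ENNReal.ofReal (4096 * (√1 + 1 + l)) *
          ∑ k ∈ Finset.Icc a b, ‖unitProj k f‖ₑ ^ 4) ^ (1 / 4 : ℝ) :=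
        ENNReal.rpow_le_rpow key (by norm_num)
    _ ≤ _ := by
        rw [ENNReal.mul_rpow_of_nonneg _ _ (by norm_num)]
        refine mul_le_mul_left (ofReal_rpow_inv_four_le (by positivity) ?_) _
        have h2 : √l ^ 4 = l ^ 2 := by
          rw [show 4 = 2 * 2 from rfl, pow_mul, Real.sq_sqrt (by linarith)]
        rw [mul_pow, h2, Real.sqrt_one]
        nlinarith

/-- The sum of the geometric series of ratio `2 ^ (-1 / 8)`. -/
def dyadicConst : ℝ := (1 - (2 : ℝ) ^ (-(1 / 8) : ℝ))⁻¹

theorem dyadic_ratio_lt_one : (2 : ℝ) ^ (-(1 / 8) : ℝ) < 1 :=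
  Real.rpow_lt_one_of_one_lt_of_neg (by norm_num) (by norm_num)

theorem dyadicConst_pos : 0 < dyadicConst := inv_pos.2 (sub_pos.2 dyadic_ratio_lt_one)

/-- The fourth root at scale `n` splits into `T^{1/8} 2^{-n/8}`, which sums geometrically, and `(1 +
l)^{1/4}`, which is paid once per scale. The condition on `L` makes the Bernstein remainder at most
`1`; the factor `8` is `4096^{1/4}`. -/
theorem L4norm_freqProj_le_of_le_two_pow {a b : ℤ} (hab : a ≤ b) (u : ℝ → L2) {T : ℝ} (hT : 0 < T)
    {L : ℕ} (hL : ((b : ℝ) - a) * ((b : ℝ) - a + 1) * T ≤ 2 ^ L) {l : ℝ} (hl : 0 ≤ l)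
    (hlog : Real.log ((b : ℝ) - a) = l) :
    L4norm T (fun t => freqProj a b (u t)) ≤
      ENNReal.ofReal (2 * (8 * dyadicConst * T ^ (1 / 8 : ℝ) +
        8 * (L + 1) * (1 + l) ^ (1 / 4 : ℝ) + 1)) * vSum a b (pullback u) ^ (1 / 4 : ℝ) := by
  refine (L4norm_freqProj_le hab u hT L).trans ?_
  refine mul_le_mul_left ?_ _
  set r : ℝ := (2 : ℝ) ^ (-(1 / 8) : ℝ) with hr
  have hr0 : 0 < r := by positivity
  set p : ℕ → ℝ := fun n => T ^ (1 / 8 : ℝ) * r ^ n with hp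
  have hp0 : ∀ n, 0 ≤ p n := fun n => by positivity
  set q : ℝ := (1 + l) ^ (1 / 4 : ℝ) with hq
  have hq0 : 0 ≤ q := by positivity
  have hq4 : q ^ 4 = 1 + l := by
    rw [hq, ← Real.rpow_natCast, ← Real.rpow_mul (by linarith)]; norm_num
  have hr8 : r ^ 8 = 1 / 2 := by
    rw [hr, ← Real.rpow_natCast, ← Real.rpow_mul (by norm_num)]
    norm_num [Real.rpow_neg_one]
  have hT8 : (T ^ (1 / 8 : ℝ)) ^ 8 = T := by
    rw [← Real.rpow_natCast, ← Real.rpow_mul hT.le]; norm_num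
  have hp4 : ∀ n, √(T / 2 ^ n) = p n ^ 4 := fun n => by
    have : T / 2 ^ n = (p n ^ 4) ^ 2 := by
      rw [← pow_mul, hp, mul_pow, hT8, ← pow_mul, mul_comm n, pow_mul, hr8, one_div, inv_pow]
      rfl
    rw [this, Real.sqrt_sq (by positivity)]
  have h1 : ∀ n ∈ Finset.range (L + 1), ENNReal.ofReal
      (4096 * (√(T / 2 ^ n) + 1 + Real.log ((b : ℝ) - a))) ^ (1 / 4 : ℝ) ≤
        ENNReal.ofReal (8 * (p n + q)) := fun n _ => by
    refine ofReal_rpow_inv_four_le (by have := hp0 n; positivity) ?_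
    rw [hp4, hlog, add_assoc, ← hq4, mul_pow]
    have : p n ^ 4 + q ^ 4 ≤ (p n + q) ^ 4 := by
      have := hp0 n
      have h0 : 0 ≤ 4 * p n ^ 3 * q + 6 * p n ^ 2 * q ^ 2 + 4 * p n * q ^ 3 := by positivity
      linarith [show (p n + q) ^ 4 = p n ^ 4 + q ^ 4 +
        (4 * p n ^ 3 * q + 6 * p n ^ 2 * q ^ 2 + 4 * p n * q ^ 3) by ring]
    linarith
  have h2 : ENNReal.ofReal (((b : ℝ) - a) * ((b : ℝ) - a + 1) * (T / 2 ^ L)) ^ (1 / 4 : ℝ) ≤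
      ENNReal.ofReal 1 := by
    refine ofReal_rpow_inv_four_le zero_le_one ?_
    rw [one_pow, ← mul_div_assoc]
    exact div_le_one_of_le₀ hL (by positivity)
  have h3 : ∑ n ∈ Finset.range (L + 1), 8 * (p n + q) ≤
      8 * dyadicConst * T ^ (1 / 8 : ℝ) + 8 * (L + 1) * q := by
    have hgeo : ∑ n ∈ Finset.range (L + 1), r ^ n ≤ dyadicConst := by
      rw [dyadicConst, ← tsum_geometric_of_lt_one hr0.le dyadic_ratio_lt_one]
      exact (summable_geometric_of_lt_one hr0.le dyadic_ratio_lt_one).sum_le_tsum _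
        fun n _ => by positivity
    rw [← Finset.mul_sum, Finset.sum_add_distrib, Finset.sum_const, Finset.card_range, hp,
      ← Finset.mul_sum, nsmul_eq_mul]
    have hT0 : 0 ≤ T ^ (1 / 8 : ℝ) := by positivity
    push_cast
    nlinarith [mul_le_mul_of_nonneg_left hgeo hT0]
  have hD := dyadicConst_pos
  calc _ ≤ 2 * (∑ n ∈ Finset.range (L + 1), ENNReal.ofReal (8 * (p n + q)) + ENNReal.ofReal 1) :=
        mul_le_mul_right (add_le_add (Finset.sum_le_sum h1) h2) _
    _ = ENNReal.ofReal (2 * (∑ n ∈ Finset.range (L + 1), 8 * (p n + q) + 1)) := by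
        have h4 : ∀ n ∈ Finset.range (L + 1), 0 ≤ 8 * (p n + q) := fun n _ => by
          have := hp0 n; positivity
        rw [ENNReal.ofReal_mul (by norm_num), ENNReal.ofReal_add (Finset.sum_nonneg h4) zero_le_one,
          ENNReal.ofReal_sum_of_nonneg h4, ENNReal.ofReal_ofNat]
    _ ≤ _ := ENNReal.ofReal_le_ofReal (by linarith)

theorem one_le_sub_of_lt {a b : ℤ} (hab : a < b) : (1 : ℝ) ≤ (b : ℝ) - a := by
  have : ((a + 1 : ℤ) : ℝ) ≤ b := by exact_mod_cast hab
  push_cast at this; linarith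

/-- The `V²` estimate on long time intervals, with explicit dependence on time and frequency. -/
theorem L4norm_freqProj_le_of_one_le {a b : ℤ} (hab : a < b) (u : ℝ → L2) {T : ℝ} (hT : 1 ≤ T) :
    L4norm T (fun t => freqProj a b (u t)) ≤
      ENNReal.ofReal (16 * dyadicConst * T ^ (1 / 8 : ℝ) +
        64 * (1 + Real.log ((b : ℝ) - a) + Real.log T) *
          (1 + Real.log ((b : ℝ) - a)) ^ (1 / 4 : ℝ) + 2) *
        vSum a b (pullback u) ^ (1 / 4 : ℝ) := by
  have hN := one_le_sub_of_lt hab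
  set N : ℝ := (b : ℝ) - a with hNdef
  have hl : 0 ≤ Real.log N := Real.log_nonneg hN
  have hlT : 0 ≤ Real.log T := Real.log_nonneg hT
  set Z : ℝ := N * (N + 1) * T with hZ
  have hZ1 : 1 ≤ Z := by
    have h1 : 1 ≤ N * (N + 1) := by nlinarith
    nlinarith
  have hZ0 : 0 < Z := by linarith
  have h2 : 0 < Real.log 2 := Real.log_pos (by norm_num)
  -- This is the least number of halvings with `Z ≤ 2 ^ L`, and it is logarithmic in both `N` and
  -- `T`.
  set L := ⌈Real.log Z / Real.log 2⌉₊ with hL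
  have hZL : Z ≤ 2 ^ L := by
    rw [← Real.log_le_log_iff hZ0 (by positivity), Real.log_pow, ← div_le_iff₀ h2]
    exact Nat.le_ceil _
  have hLle : (L : ℝ) + 1 ≤ 4 * (1 + Real.log N + Real.log T) := by
    have h3 : (L : ℝ) < Real.log Z / Real.log 2 + 1 :=
      Nat.ceil_lt_add_one (div_nonneg (Real.log_nonneg hZ1) h2.le)
    have h4 : Real.log Z ≤ Real.log 2 + 2 * Real.log N + Real.log T := by
      have : Z ≤ 2 * N ^ 2 * T := 
        mul_le_mul_of_nonneg_right (by nlinarith) (by linarith)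
      refine (Real.log_le_log hZ0 this).trans (le_of_eq ?_)
      rw [Real.log_mul (by positivity) (by positivity), Real.log_mul (by norm_num) (by positivity),
        Real.log_pow]
      norm_num
    have h5 : Real.log Z / Real.log 2 ≤ 1 + 4 * Real.log N + 2 * Real.log T := by
      rw [div_le_iff₀ h2]
      nlinarith [Real.log_two_gt_d9]
    linarith
  refine (L4norm_freqProj_le_of_le_two_pow hab.le u (by linarith) hZL hl rfl).trans ?_
  refine mul_le_mul_left (ENNReal.ofReal_le_ofReal ?_) _
  have hq : 0 ≤ (1 + Real.log N) ^ (1 / 4 : ℝ) := by positivity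
  nlinarith [mul_le_mul_of_nonneg_right hLle hq]

theorem L4norm_mono {T T' : ℝ} (h : T ≤ T') (u : ℝ → L2) : L4norm T u ≤ L4norm T' u :=
  ENNReal.rpow_le_rpow (lintegral_mono_set (Icc_subset_Icc le_rfl h)) (by norm_num)

theorem L4norm_one_freqProj_le {β : ℝ} (hβ : 1 < β) {a b : ℤ} (hab : a + 2 ≤ b) (u : ℝ → L2) :
    L4norm 1 (fun t => freqProj a b (u t)) ≤
      ENNReal.ofReal ((16 * dyadicConst + 66) * 3 ^ (β + 1 / 2) *
        Real.log ((b : ℝ) - a) ^ (β + 1 / 2)) * vSum a b (pullback u) ^ (1 / 4 : ℝ) := by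
  have hl := half_le_log hab
  refine (L4norm_freqProj_le_of_one_le (by omega : a < b) u le_rfl).trans ?_
  refine mul_le_mul_left (ENNReal.ofReal_le_ofReal ?_) _
  set l := Real.log ((b : ℝ) - a)
  rw [Real.one_rpow, Real.log_one, add_zero, mul_assoc _ (3 ^ (β + 1 / 2)),
    ← Real.mul_rpow (by norm_num) (by linarith)]
  -- One power of `1 + l` counts the scales and the quarter power is the loss at each scale.
  have h1 : (1 + l) * (1 + l) ^ (1 / 4 : ℝ) = (1 + l) ^ (5 / 4 : ℝ) := by
    rw [← Real.rpow_one_add' (by linarith) (by norm_num)]; norm_num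
  have h2 : (1 + l) ^ (5 / 4 : ℝ) ≤ (1 + l) ^ (β + 1 / 2) :=
    Real.rpow_le_rpow_of_exponent_le (by linarith) (by linarith)
  have h3 : (1 + l) ^ (β + 1 / 2) ≤ (3 * l) ^ (β + 1 / 2) :=
    Real.rpow_le_rpow (by linarith) (by linarith) (by linarith)
  have h4 : 1 ≤ (1 + l) ^ (5 / 4 : ℝ) := Real.one_le_rpow (by linarith) (by norm_num)
  have hD := dyadicConst_pos
  rw [mul_assoc 64, h1]
  nlinarith

/-- The constant in the polynomial form of the `V²` estimate. -/
def polyConst (β : ℝ) : ℝ := 16 * dyadicConst + 64 * (256 + 2 * (1 + 2 / β) ^ 2) + 2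

/-- The product of logarithms is at most `2(1 + l)² + (ln T)²`. Each square is absorbed by a power,
using `ln x ≤ x^ε/ε` with `ε = 1/16` for `T` and `ε = β/2` for `N`. -/
theorem L4norm_freqProj_le_poly {β : ℝ} (hβ : 0 < β) {a b : ℤ} (hab : a < b) (u : ℝ → L2) {T : ℝ}
    (hT : 1 ≤ T) :
    L4norm T (fun t => freqProj a b (u t)) ≤
      ENNReal.ofReal (polyConst β * (T ^ (1 / 8 : ℝ) + ((b : ℝ) - a) ^ β)) *
        vSum a b (pullback u) ^ (1 / 4 : ℝ) := by
  have hN := one_le_sub_of_lt hab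
  refine (L4norm_freqProj_le_of_one_le hab u hT).trans ?_
  refine mul_le_mul_left (ENNReal.ofReal_le_ofReal ?_) _
  set N : ℝ := (b : ℝ) - a with hNdef
  set l := Real.log N
  have hl : 0 ≤ l := Real.log_nonneg hN
  have hlT : 0 ≤ Real.log T := Real.log_nonneg hT
  have hD := dyadicConst_pos
  have h1 : Real.log T ^ 2 ≤ 256 * T ^ (1 / 8 : ℝ) := by
    have h := Real.log_le_rpow_div (by linarith : 0 ≤ T) (show (0 : ℝ) < 1 / 16 by norm_num)
    have e : T ^ (1 / 8 : ℝ) = (T ^ (1 / 16 : ℝ)) ^ 2 := by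
      rw [← Real.rpow_natCast, ← Real.rpow_mul (by linarith)]; norm_num
    rw [e]
    calc Real.log T ^ 2 ≤ (T ^ (1 / 16 : ℝ) / (1 / 16)) ^ 2 := pow_le_pow_left₀ hlT h 2
      _ = _ := by ring
  have h2 : (1 + l) ^ 2 ≤ (1 + 2 / β) ^ 2 * N ^ β := by
    have h := Real.log_le_rpow_div (by linarith : 0 ≤ N) (show (0 : ℝ) < β / 2 by linarith)
    have e : N ^ β = (N ^ (β / 2)) ^ 2 := by
      rw [← Real.rpow_natCast, ← Real.rpow_mul (by linarith)]; norm_num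
    have h3 : 1 ≤ N ^ (β / 2) := Real.one_le_rpow hN (by linarith)
    rw [e, ← mul_pow]
    refine pow_le_pow_left₀ (by linarith) ?_ 2
    calc 1 + l ≤ N ^ (β / 2) + N ^ (β / 2) / (β / 2) := add_le_add h3 h
      _ = _ := by field_simp
  have h3 : (1 + l) ^ (1 / 4 : ℝ) ≤ 1 + l := by
    calc (1 + l) ^ (1 / 4 : ℝ) ≤ (1 + l) ^ (1 : ℝ) :=
          Real.rpow_le_rpow_of_exponent_le (by linarith) (by norm_num)
      _ = _ := Real.rpow_one _
  have h4 : (1 + l + Real.log T) * (1 + l) ^ (1 / 4 : ℝ) ≤ 2 * (1 + l) ^ 2 + Real.log T ^ 2 := by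
    have := mul_le_mul_of_nonneg_left h3 (show 0 ≤ 1 + l + Real.log T by linarith)
    nlinarith [sq_nonneg (1 + l - Real.log T)]
  have h5 : 1 ≤ T ^ (1 / 8 : ℝ) := Real.one_le_rpow hT (by norm_num)
  have h6 : 0 ≤ N ^ β := by positivity
  set t := T ^ (1 / 8 : ℝ)
  set n := N ^ β
  set κ := (1 + 2 / β) ^ 2
  have hκ : 0 ≤ κ := by positivity
  have h7 : 16 * dyadicConst * t + 64 * (2 * (κ * n) + 256 * t) + 2 ≤ polyConst β * (t + n) := by
    have e : polyConst β = 16 * dyadicConst + 64 * (256 + 2 * κ) + 2 := rfl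
    rw [e]
    have h8 : 0 ≤ dyadicConst * n := by positivity
    have h9 : 0 ≤ κ * t := by positivity
    linarith
  rw [mul_assoc 64]
  linarith

/-- There are three regimes for `N = |I| ≥ 1`. For `T ≥ 1` the polynomial bound is squared. For `T <
1` the target contains `N^{2β} z^{(1-θ)/2}` with `z = N√T`: if `z ≤ 1`, Bernstein gives `O(z) ≤
O(z^{(1-θ)/2})`; if `z > 1`, enlarging the time interval to `[0, 1]` gives `O(N^{2β})`. -/
theorem L4norm_sq_freqProj_le {θ β : ℝ} (hθ : 0 < θ) (hθ1 : θ < 1) (hβ : 0 < β) {a b : ℤ}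
    (hab : a ≤ b) {T : ℝ} (hT : 0 < T) (u : ℝ → L2) :
    L4norm T (fun t => freqProj a b (u t)) ^ 2 ≤
      ENNReal.ofReal ((4 * polyConst β ^ 2 + 2) *
        (T ^ ((1 - θ) / 4) * ((b : ℝ) - a) ^ (2 * β + (1 - θ) / 2) + T ^ (1 / 4 : ℝ))) *
        vSum a b (pullback u) ^ (1 / 2 : ℝ) := by
  set S := vSum a b (pullback u)
  have hbern := L4norm_freqProj_le_bernstein hab u T
  -- When `a = b` the Bernstein constant vanishes, so the left side is zero.
  rcases hab.eq_or_lt with rfl | hlt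
  · have : L4norm T (fun t => freqProj a a (u t)) = 0 := by
      simpa using hbern
    rw [this]; simp
  have hN := one_le_sub_of_lt hlt
  set N : ℝ := (b : ℝ) - a with hNdef
  have hN0 : 0 < N := by linarith
  set P := polyConst β
  have hP : 0 ≤ P := by
    have := dyadicConst_pos
    simp only [P, polyConst]; positivity
  have hx : 0 < N ^ (2 * β) := by positivity
  have hsplit : N ^ (2 * β + (1 - θ) / 2) = N ^ (2 * β) * N ^ ((1 - θ) / 2) :=
    Real.rpow_add hN0 _ _
  have hNβ : (N ^ β) ^ 2 = N ^ (2 * β) := by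
    rw [← Real.rpow_natCast, ← Real.rpow_mul hN0.le, mul_comm]; norm_num
  have hN1 : 1 ≤ N ^ ((1 - θ) / 2) := Real.one_le_rpow hN (by linarith)
  have hN2 : 1 ≤ N ^ (2 * β) := Real.one_le_rpow hN (by linarith)
  have hT4 : 0 < T ^ (1 / 4 : ℝ) := by positivity
  rw [hsplit]
  rcases le_or_gt 1 T with hT1 | hT1
  · have h1 := pow_le_pow_left' (L4norm_freqProj_le_poly hβ hlt u hT1) 2
    rw [ofReal_mul_rpow_inv_four_sq (by positivity)] at h1
    refine h1.trans (mul_le_mul_left (ENNReal.ofReal_le_ofReal ?_) _)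
    have hTe : (T ^ (1 / 8 : ℝ)) ^ 2 = T ^ (1 / 4 : ℝ) := by
      rw [← Real.rpow_natCast, ← Real.rpow_mul hT.le]; norm_num
    have hTθ : 1 ≤ T ^ ((1 - θ) / 4) := Real.one_le_rpow hT1 (by linarith)
    have h2 : (T ^ (1 / 8 : ℝ) + N ^ β) ^ 2 ≤ 2 * (N ^ (2 * β) + T ^ (1 / 4 : ℝ)) := by
      rw [← hNβ, ← hTe]
      nlinarith [sq_nonneg (T ^ (1 / 8 : ℝ) - N ^ β)]
    have h3 : N ^ (2 * β) ≤ T ^ ((1 - θ) / 4) * (N ^ (2 * β) * N ^ ((1 - θ) / 2)) := by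
      calc N ^ (2 * β) = 1 * (N ^ (2 * β) * 1) := by ring
        _ ≤ _ := by gcongr
    rw [mul_pow]
    have hP2 := sq_nonneg P
    calc P ^ 2 * (T ^ (1 / 8 : ℝ) + N ^ β) ^ 2
        ≤ P ^ 2 * (2 * (T ^ ((1 - θ) / 4) * (N ^ (2 * β) * N ^ ((1 - θ) / 2)) +
            T ^ (1 / 4 : ℝ))) := by
          refine mul_le_mul_of_nonneg_left (h2.trans ?_) hP2
          linarith
      _ ≤ _ := by
          rw [← mul_assoc]
          refine mul_le_mul_of_nonneg_right (by linarith) (by positivity)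
  · set z : ℝ := N * √T with hz
    have hz0 : 0 < z := mul_pos hN0 (Real.sqrt_pos.2 hT)
    have hzθ : z ^ ((1 - θ) / 2) = N ^ ((1 - θ) / 2) * T ^ ((1 - θ) / 4) := by
      rw [hz, Real.mul_rpow hN0.le (Real.sqrt_nonneg T), Real.sqrt_eq_rpow,
        ← Real.rpow_mul hT.le]
      congr 2; ring
    have htarget : T ^ ((1 - θ) / 4) * (N ^ (2 * β) * N ^ ((1 - θ) / 2)) =
        N ^ (2 * β) * z ^ ((1 - θ) / 2) := by rw [hzθ]; ring
    rw [htarget]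
    have hzp : 0 < z ^ ((1 - θ) / 2) := by positivity
    rcases le_or_gt z 1 with hz1 | hz1
    · have h1 : ENNReal.ofReal (N * (N + 1) * T) ^ (1 / 4 : ℝ) ≤ ENNReal.ofReal √(2 * z) := by
        refine ofReal_rpow_inv_four_le (Real.sqrt_nonneg _) ?_
        rw [show 4 = 2 * 2 from rfl, pow_mul, Real.sq_sqrt (by positivity), hz, mul_pow, mul_pow,
          Real.sq_sqrt hT.le]
        nlinarith [mul_nonneg hT.le (show 0 ≤ N * (N - 1) from by nlinarith), mul_pos hT hN0]
      have h2 := pow_le_pow_left' (hbern.trans (mul_le_mul_left h1 _)) 2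
      rw [ofReal_mul_rpow_inv_four_sq (Real.sqrt_nonneg _), Real.sq_sqrt (by positivity)] at h2
      refine h2.trans (mul_le_mul_left (ENNReal.ofReal_le_ofReal ?_) _)
      have h3 : z ≤ z ^ ((1 - θ) / 2) := by
        calc z = z ^ (1 : ℝ) := (Real.rpow_one z).symm
          _ ≤ _ := Real.rpow_le_rpow_of_exponent_ge hz0 hz1 (by linarith)
      have h4 : z ^ ((1 - θ) / 2) ≤ N ^ (2 * β) * z ^ ((1 - θ) / 2) :=
        le_mul_of_one_le_left hzp.le hN2
      have hP2 := sq_nonneg P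
      nlinarith
    · have h1 := pow_le_pow_left' ((L4norm_mono hT1.le _).trans
        (L4norm_freqProj_le_poly hβ hlt u le_rfl)) 2
      rw [ofReal_mul_rpow_inv_four_sq (by positivity)] at h1
      refine h1.trans (mul_le_mul_left (ENNReal.ofReal_le_ofReal ?_) _)
      have h3 : N ^ (2 * β) ≤ N ^ (2 * β) * z ^ ((1 - θ) / 2) :=
        le_mul_of_one_le_right hx.le (Real.one_le_rpow hz1.le (by linarith))
      have h5 : (1 : ℝ) ≤ N ^ β := Real.one_le_rpow hN hβ.le
      have h6 : ((1 : ℝ) + N ^ β) ^ 2 ≤ 4 * N ^ (2 * β) := by rw [← hNβ]; nlinarith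
      rw [Real.one_rpow, mul_pow]
      have hP2 := sq_nonneg P
      calc P ^ 2 * (1 + N ^ β) ^ 2 ≤ P ^ 2 * (4 * (N ^ (2 * β) * z ^ ((1 - θ) / 2))) :=
            mul_le_mul_of_nonneg_left (h6.trans (by linarith)) hP2
        _ ≤ _ := by nlinarith

end LogRestriction

end

theorem lemma3p6 :
    (∃ C : ℝ≥0, ∀ a b : ℤ, a + 2 ≤ b → ∀ σ : ℝ, σ = 1 ∨ σ = -1 → ∀ u₀ : LogRestriction.L2,
      LogRestriction.L4norm 1
          (fun t => LogRestriction.freqProj a b (LogRestriction.schrodinger (σ * t) u₀)) ≤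
        C * ENNReal.ofReal (Real.sqrt (Real.log ((b : ℝ) - a))) *
          (∑ k ∈ Finset.Icc a b, ‖LogRestriction.unitProj k u₀‖ₑ ^ (4 : ℕ)) ^ (1 / 4 : ℝ)) ∧
    (∀ β : ℝ, 1 < β → ∃ C : ℝ≥0, ∀ a b : ℤ, a + 2 ≤ b → ∀ u : ℝ → LogRestriction.L2,
      (∀ k ∈ Finset.Icc a b, LogRestriction.MemVDelta 2 (fun t => LogRestriction.unitProj k (u t))) →
      LogRestriction.L4norm 1 (fun t => LogRestriction.freqProj a b (u t)) ≤
        C * ENNReal.ofReal (Real.log ((b : ℝ) - a) ^ (β + 1 / 2)) *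
          (∑ k ∈ Finset.Icc a b,
            LogRestriction.vDeltaNorm 2 (fun t => LogRestriction.unitProj k (u t)) ^ (4 : ℕ))
              ^ (1 / 4 : ℝ)) ∧
    (∀ θ : ℝ, 0 < θ → θ < 1 → ∀ β : ℝ, 0 < β → ∃ C : ℝ≥0, ∀ a b : ℤ, a ≤ b → ∀ T : ℝ, 0 < T →
      ∀ u : ℝ → LogRestriction.L2,
      (∀ k ∈ Finset.Icc a b, LogRestriction.MemVDelta 2 (fun t => LogRestriction.unitProj k (u t))) →
      LogRestriction.L4norm T (fun t => LogRestriction.freqProj a b (u t)) ^ (2 : ℕ) ≤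
        C * ENNReal.ofReal
            (T ^ ((1 - θ) / 4) * ((b : ℝ) - a) ^ (2 * β + (1 - θ) / 2) + T ^ (1 / 4 : ℝ)) *
          (∑ k ∈ Finset.Icc a b,
            LogRestriction.vDeltaNorm 2 (fun t => LogRestriction.unitProj k (u t)) ^ (4 : ℕ))
              ^ (1 / 2 : ℝ)) := by
  have hD := LogRestriction.dyadicConst_pos
  refine ⟨⟨16, fun a b hab σ hσ u₀ => ?_⟩, fun β hβ =>
    ⟨Real.toNNReal ((16 * LogRestriction.dyadicConst + 66) * 3 ^ (β + 1 / 2)),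
      fun a b hab u _ => ?_⟩, fun θ hθ hθ1 β hβ =>
    ⟨Real.toNNReal (4 * LogRestriction.polyConst β ^ 2 + 2), fun a b hab T hT u _ => ?_⟩⟩
  · refine (LogRestriction.L4norm_one_schrodinger_le hab hσ u₀).trans (le_of_eq ?_)
    rw [ENNReal.ofReal_mul (by norm_num)]
    simp
  · refine (LogRestriction.L4norm_one_freqProj_le hβ hab u).trans (le_of_eq ?_)
    rw [LogRestriction.vSum_pullback, ENNReal.ofReal_mul (by positivity)]
    rfl
  · refine (LogRestriction.L4norm_sq_freqProj_le hθ hθ1 hβ hab hT u).trans (le_of_eq ?_)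
    rw [LogRestriction.vSum_pullback, ENNReal.ofReal_mul (by positivity)]
    rfl
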